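/- Let $p$ be a prime, $N\in\mathbb N$ and $s>-1$. Write $(a;q)_n=\prod_{j=0}^{n-1}(1-aq^j)$. Every $\mathbf Z\in\mathrm{Mat}(N,\mathbb Q_p)$ can be written as $\mathbf Z=\mathbf B\,\mathrm{diag}(p^{-k_1},\dots,p^{-k_N})\,\mathbf C$ with $\mathbf B,\mathbf C\in \mathrm{GL}(N,\mathbb Z_p)$ and $k_1\ge\cdots\ge k_N$ in $\mathbb Z\cup\{-\infty\}$ (where $p^{\infty}=0$); the tuple $\mathrm{Sing}_N(\mathbf Z)=(k_1,\dots,k_N)$ is unique, and its entries are the singular numbers of $\mathbf Z$. Let $\Delta_N$ be the set of all $\mathbf k=(k_1\ge\cdots\ge k_N)$ with entries in $\mathbb Z\cup\{-\infty\}$, and for $\mathbf k\in\Delta_N$ put $l_i=l_i(\mathbf k)=\#\{j:k_j=i\}$. Let $\mathsf{vol}$ be the additive Haar measure on $\mathrm{Mat}(N,\mathbb Q_p)$ with $\mathsf{vol}(\mathrm{Mat}(N,\mathbb Z_p))=1$, let $\gamma(\mathbf Z)=\prod_{k_j>0}p^{k_j}$, let $\mathsf M_N^{(s)}$ be the $p$-adic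 Hua probability measure $$d\mathsf M_N^{(s)}(\mathbf Z)=\frac{(p^{-1-s};p^{-1})_N^2}{(p^{-1-s};p^{-1})_{2N}}\,\gamma(\mathbf Z)^{-s-2N}\,d\mathsf{vol}(\mathbf Z),$$ and let $\mathsf m_N^{(s)}=(\mathrm{Sing}_N)_*\mathsf M_N^{(s)}$ be the law on $\Delta_N$ of the singular numbers of an $\mathsf M_N^{(s)}$-distributed matrix. For $r>-1$ and integers $x,y\ge0$ let $$\mathsf P^{(r)}(x,y)=\frac{p^{-y^2-ry}\,(p^{-1};p^{-1})_{x}\,(p^{-1-r};p^{-1})_{x}}{(p^{-1};p^{-1})_{y}\,(p^{-1};p^{-1})_{x-y}\,(p^{-1-r};p^{-1})_{y}}\,\mathbf 1(y\le x),$$ and for $0\le x\le N$ let $$\tilde\pi_N^{(s)}(x)=\frac{(p^{-1-s};p^{-1})_N^2\,(p^{-1};p^{-1})_N^2}{(p^{-1-s};p^{-1})_{2N}\,(p^{-1};p^{-1})_x\,(p^{-1-s};p^{-1})_x\,(p^{-1};p^{-1})_{N-x}^2}\,p^{-(N-x)^2}.$$ Then $\tilde\pi_N^{(s)}$ is a probability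 measure on $\{0,\dots,N\}$, the kernels $\mathsf P^{(s)}$ and $\mathsf P^{(0)}$ are Markov kernels on $\{0,1,2,\dots\}$, $\mathsf M_N^{(s)}$ and $\mathsf m_N^{(s)}$ are probability measures, and $\mathsf m_N^{(s)}$ is sampled by the following procedure for a pair of random sequences $(X_i)_{i\ge0}$, $(Y_i)_{i\ge 0}$: 1. draw $X_0$ from $\tilde\pi_N^{(s)}$ and put $Y_0=N-X_0$; 2. starting from $X_0$, run a Markov chain $X_0,X_1,X_2,\dots$ with transition kernel $\mathsf P^{(s)}$; 3. starting from $Y_0$, run a Markov chain $Y_0,Y_1,Y_2,\dots$ with transition kernel $\mathsf P^{(0)}$, conditionally independent of $(X_i)_{i\ge 0}$ given $X_0$. That is: if $\mathbf k$ has law $\mathsf m_N^{(s)}$, then $$X_i=\sum_{j\ge i}l_j(\mathbf k),\qquad Y_i=N-\sum_{j\ge -i}l_j(\mathbf k)\qquad(i\ge0)\qquad(\ast)$$ (sums over integers $j$) have the joint law described in 1--3. Conversely, if $X,Y$ are sampled by 1--3 on some probability space, then there is a random $\mathbf k\in\Delta_N$ on that space for which $(\ast)$ holds almost surely, and every random $\mathbf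 k\in\Delta_N$ for which $(\ast)$ holds almost surely has law $\mathsf m_N^{(s)}$. -/

import Mathlib

noncomputable section

namespace PadicHua

open MeasureTheory

/-! ## Matrices over the `p`-adic numbers and the volume -/

/-- The Borel σ-algebra on `Mat(N, ℚ_p)`, for the topology of entrywise convergence. -/
instance instMeasurableSpaceMat (p : ℕ) [Fact p.Prime] (N : ℕ) :
    MeasurableSpace (Matrix (Fin N) (Fin N) ℚ_[p]) :=
  borel _

instance instBorelSpaceMat (p : ℕ) [Fact p.Prime] (N : ℕ) :
    BorelSpace (Matrix (Fin N) (Fin N) ℚ_[p]) :=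
  ⟨rfl⟩

/-- The set `Mat(N, ℤ_p)` inside `Mat(N, ℚ_p)`. -/
def integerMatrices (p : ℕ) [Fact p.Prime] (N : ℕ) : Set (Matrix (Fin N) (Fin N) ℚ_[p]) :=
  {Z | ∀ i j, ‖Z i j‖ ≤ 1}

theorem integerMatrices_eq_pi (p : ℕ) [Fact p.Prime] (N : ℕ) :
    integerMatrices p N =
      Set.univ.pi fun _ : Fin N => Set.univ.pi fun _ : Fin N =>
        Metric.closedBall (0 : ℚ_[p]) 1 := by
  ext Z
  constructor
  · intro h i _ j _
    exact mem_closedBall_zero_iff.mpr (h i j)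
  · intro h i j
    exact mem_closedBall_zero_iff.mp (h i (Set.mem_univ i) j (Set.mem_univ j))

theorem isCompact_integerMatrices (p : ℕ) [Fact p.Prime] (N : ℕ) :
    IsCompact (integerMatrices p N) := by
  rw [integerMatrices_eq_pi]
  exact isCompact_univ_pi fun _ => isCompact_univ_pi fun _ => isCompact_closedBall _ _

theorem isOpen_integerMatrices (p : ℕ) [Fact p.Prime] (N : ℕ) :
    IsOpen (integerMatrices p N) := by
  rw [integerMatrices_eq_pi]
  exact isOpen_set_pi Set.finite_univ fun _ _ => isOpen_set_pi Set.finite_univ fun _ _ =>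
    IsUltrametricDist.isOpen_closedBall (0 : ℚ_[p]) one_ne_zero

/-- `Mat(N, ℤ_p)` as a compact set with non-empty interior. -/
def integerMatricesCompacts (p : ℕ) [Fact p.Prime] (N : ℕ) :
    TopologicalSpace.PositiveCompacts (Matrix (Fin N) (Fin N) ℚ_[p]) where
  carrier := integerMatrices p N
  isCompact' := isCompact_integerMatrices p N
  interior_nonempty' := by
    rw [(isOpen_integerMatrices p N).interior_eq]
    exact ⟨0, fun i j => by simp⟩

/-- The Haar measure `vol` of the additive group `Mat(N, ℚ_p)`, normalized by
`vol (Mat(N, ℤ_p)) = 1`. -/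
def vol (p : ℕ) [Fact p.Prime] (N : ℕ) : Measure (Matrix (Fin N) (Fin N) ℚ_[p]) :=
  Measure.addHaarMeasure (integerMatricesCompacts p N)

theorem vol_integerMatrices (p : ℕ) [Fact p.Prime] (N : ℕ) :
    vol p N (integerMatrices p N) = 1 :=
  Measure.addHaarMeasure_self (K₀ := integerMatricesCompacts p N)

/-! ## Singular numbers -/

/-- The set `Δ_N` of `N`-tuples `k_1 ≥ k_2 ≥ ⋯ ≥ k_N` with entries in `ℤ ∪ {-∞}`; here `-∞`
is `⊥ : WithBot ℤ`. -/
def Delta (N : ℕ) : Type :=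
  {k : Fin N → WithBot ℤ // Antitone k}

/-- `Δ_N` is countable, so its Borel σ-algebra (in the topology induced by the product topology,
where points are closed) consists of all subsets. -/
instance instMeasurableSpaceDelta (N : ℕ) : MeasurableSpace (Delta N) := ⊤

/-- The element `(-∞, …, -∞)` of `Δ_N`. -/
instance instInhabitedDelta (N : ℕ) : Inhabited (Delta N) :=
  ⟨⟨fun _ => ⊥, fun _ _ _ => le_rfl⟩⟩

/-- The `p`-adic number `p^{-k}` for `k ∈ ℤ ∪ {-∞}`, where `p^{-(-∞)} = p^{∞} = 0`. -/
def primePowNeg (p : ℕ) [Fact p.Prime] : WithBot ℤ → ℚ_[p]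
  | ⊥ => 0
  | (k : ℤ) => (p : ℚ_[p]) ^ (-k)

/-- `Z = B · diag(p^{-k_1}, …, p^{-k_N}) · C` for some `B, C ∈ GL(N, ℤ_p)`. -/
def HasSingularNumbers {p : ℕ} [Fact p.Prime] {N : ℕ} (Z : Matrix (Fin N) (Fin N) ℚ_[p])
    (k : Delta N) : Prop :=
  ∃ B C : Matrix.GeneralLinearGroup (Fin N) ℤ_[p],
    Z = (B : Matrix (Fin N) (Fin N) ℤ_[p]).map (fun a : ℤ_[p] => (a : ℚ_[p])) *
      Matrix.diagonal (fun j => primePowNeg p (k.1 j)) *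
      (C : Matrix (Fin N) (Fin N) ℤ_[p]).map (fun a : ℤ_[p] => (a : ℚ_[p]))

/-- The map `Sing_N : Mat(N, ℚ_p) → Δ_N` sending a matrix to its singular numbers, that is, to the
(unique) `k ∈ Δ_N` of the decomposition `HasSingularNumbers`. -/
def Sing {p : ℕ} [Fact p.Prime] {N : ℕ} (Z : Matrix (Fin N) (Fin N) ℚ_[p]) : Delta N :=
  Classical.epsilon fun k : Delta N => HasSingularNumbers Z k

/-- `l_i(k) = #{j : k_j = i}` for `i ∈ ℤ ∪ {-∞}`. -/
def mult {N : ℕ} (k : Delta N) (i : WithBot ℤ) : ℕ :=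
  (Finset.univ.filter fun j : Fin N => k.1 j = i).card

/-- `∑_{j = i}^{∞} l_j(k)`, the sum being over the integers `j ≥ i`; it has finitely many
non-zero terms. -/
def tailSum {N : ℕ} (k : Delta N) (i : ℤ) : ℕ :=
  ∑ᶠ (j : ℤ) (_ : i ≤ j), mult k (j : WithBot ℤ)

theorem tailSum_eq_card {N : ℕ} (k : Delta N) (i : ℤ) :
    tailSum k i = (Finset.univ.filter fun j : Fin N => (i : WithBot ℤ) ≤ k.1 j).card := by
  classical
  have hsupp : (Function.support fun j : ℤ => ∑ᶠ _ : i ≤ j, mult k (j : WithBot ℤ)) ⊆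
      ((Finset.univ.image fun a : Fin N => (k.1 a).unbotD 0 : Finset ℤ) : Set ℤ) := by
    intro j hj
    have hm : mult k (j : WithBot ℤ) ≠ 0 := by
      intro h0
      apply hj
      simp [h0]
    obtain ⟨a, ha⟩ := Finset.card_pos.mp (Nat.pos_of_ne_zero hm)
    have ha' : k.1 a = j := (Finset.mem_filter.mp ha).2
    rw [Finset.mem_coe, Finset.mem_image]
    exact ⟨a, Finset.mem_univ a, by rw [ha']; rfl⟩
  unfold tailSum
  rw [finsum_eq_sum_of_support_subset _ hsupp]
  have hterm : ∀ j : ℤ, (∑ᶠ _ : i ≤ j, mult k (j : WithBot ℤ)) =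
      ((Finset.univ.filter fun a : Fin N => (i : WithBot ℤ) ≤ k.1 a).filter
        fun a => k.1 a = j).card := by
    intro j
    rw [finsum_eq_if, mult]
    split_ifs with h
    · congr 1
      ext a
      simp only [Finset.mem_filter, Finset.mem_univ, true_and]
      constructor
      · intro ha
        exact ⟨by rw [ha]; exact WithBot.coe_le_coe.mpr h, ha⟩
      · exact fun ha => ha.2
    · symm
      rw [Finset.card_eq_zero, Finset.filter_eq_empty_iff]
      intro a ha ha'
      apply h
      have := (Finset.mem_filter.mp ha).2
      rw [ha'] at this
      exact WithBot.coe_le_coe.mp this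
  rw [Finset.sum_congr rfl fun j _ => hterm j]
  rw [Finset.card_eq_sum_card_fiberwise (f := fun a : Fin N => (k.1 a).unbotD 0)
    (t := Finset.univ.image fun a : Fin N => (k.1 a).unbotD 0)
    (fun a _ => Finset.mem_coe.mpr (Finset.mem_image_of_mem _ (Finset.mem_univ a)))]
  refine Finset.sum_congr rfl fun j _ => ?_
  congr 1
  refine Finset.filter_congr fun a ha => ?_
  have hle := (Finset.mem_filter.mp ha).2
  cases hka : k.1 a with
  | bot => rw [hka] at hle; exact absurd hle (by simp)
  | coe z => exact WithBot.coe_inj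

/-- The differences `N - ∑_{j ≥ i} l_j(k)` of natural numbers are never truncated. -/
theorem tailSum_le {N : ℕ} (k : Delta N) (i : ℤ) : tailSum k i ≤ N := by
  rw [tailSum_eq_card]
  exact (Finset.card_le_univ _).trans_eq (Fintype.card_fin N)

/-! ## The `p`-adic Hua measures -/

/-- The `q`-Pochhammer symbol `(a; q)_n = ∏_{j = 0}^{n - 1} (1 - a q^j)`. -/
def qPoch (a q : ℝ) (n : ℕ) : ℝ :=
  ∏ j ∈ Finset.range n, (1 - a * q ^ j)

/-- `(p^{-1-s}; p^{-1})_n`. -/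
def pochS (p : ℕ) (s : ℝ) (n : ℕ) : ℝ :=
  qPoch ((p : ℝ) ^ (-1 - s)) ((p : ℝ)⁻¹) n

/-- `(p^{-1}; p^{-1})_n`. -/
def pochOne (p : ℕ) (n : ℕ) : ℝ :=
  qPoch ((p : ℝ)⁻¹) ((p : ℝ)⁻¹) n

/-- `p^k` if `k > 0`, and `1` if `k ≤ 0` or `k = -∞`. -/
def posPow (p : ℕ) : WithBot ℤ → ℝ
  | ⊥ => 1
  | (k : ℤ) => if 0 < k then (p : ℝ) ^ k else 1

/-- `γ(Z) = ∏_{k_j > 0} p^{k_j}`, where `k_1 ≥ ⋯ ≥ k_N` are the singular numbers of `Z`. -/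
def gam {p : ℕ} [Fact p.Prime] {N : ℕ} (Z : Matrix (Fin N) (Fin N) ℚ_[p]) : ℝ :=
  ∏ j : Fin N, posPow p ((Sing Z).1 j)

/-- The `p`-adic Hua measure `M_N^{(s)}`: the measure on `Mat(N, ℚ_p)` with density
`(p^{-1-s}; p^{-1})_N^2 / (p^{-1-s}; p^{-1})_{2N} · γ(Z)^{-s-2N}` with respect to `vol`. -/
def huaMeasure (p : ℕ) [Fact p.Prime] (N : ℕ) (s : ℝ) :
    Measure (Matrix (Fin N) (Fin N) ℚ_[p]) :=
  (vol p N).withDensity fun Z =>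
    ENNReal.ofReal (pochS p s N ^ 2 / pochS p s (2 * N) * gam Z ^ (-s - 2 * (N : ℝ)))

/-- `m_N^{(s)}`, the law of the singular numbers of an `M_N^{(s)}`-distributed matrix. -/
def singularLaw (p : ℕ) [Fact p.Prime] (N : ℕ) (s : ℝ) : Measure (Delta N) :=
  (huaMeasure p N s).map Sing

/-! ## The Markov kernel, the initial distribution and the sampling procedure -/

/-- The kernel `P^{(s)}(x, y)` on the non-negative integers. -/
def kernelP (p : ℕ) (s : ℝ) (x y : ℕ) : ℝ :=
  if y ≤ x then
    (p : ℝ) ^ (-(y : ℝ) ^ 2 - s * y) * pochOne p x * pochS p s x /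
      (pochOne p y * pochOne p (x - y) * pochS p s y)
  else 0

/-- The weights `π̃_N^{(s)}(x)`, `0 ≤ x ≤ N`, extended by `0` to all `x`. -/
def piTilde (p N : ℕ) (s : ℝ) (x : ℕ) : ℝ :=
  if x ≤ N then
    pochS p s N ^ 2 * pochOne p N ^ 2 /
      (pochS p s (2 * N) * pochOne p x * pochS p s x * pochOne p (N - x) ^ 2) *
      (p : ℝ) ^ (-((N : ℝ) - x) ^ 2)
  else 0

/-- `K` is a transition (Markov) kernel on the non-negative integers. -/
def IsTransitionKernel (K : ℕ → ℕ → ℝ) : Prop :=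
  (∀ x y, 0 ≤ K x y) ∧ ∀ x, HasSum (K x) 1

/-- The pair of random sequences `X, Y` is distributed according to the following procedure: draw
`X 0` from `π̃_N^{(s)}` and put `Y 0 = N - X 0`; from these starting points run, independently of
each other given `X 0`, a Markov chain `X` with transition kernel `P^{(s)}` and a Markov chain
`Y` with transition kernel `P^{(0)}`. This is expressed through the finite-dimensional
distributions, which determine the joint law of `(X, Y)`. -/
structure IsTwoChainSample (p N : ℕ) (s : ℝ) {Ω : Type*} [MeasurableSpace Ω] (μ : Measure Ω)
    (X Y : ℕ → Ω → ℕ) : Prop where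
  measurable_X : ∀ i, Measurable (X i)
  measurable_Y : ∀ i, Measurable (Y i)
  law : ∀ (n m : ℕ) (x y : ℕ → ℕ),
    μ {ω | (∀ i ≤ n, X i ω = x i) ∧ ∀ i ≤ m, Y i ω = y i} =
      ENNReal.ofReal
        ((piTilde p N s (x 0) * if y 0 = N - x 0 then 1 else 0) *
          (∏ i ∈ Finset.range n, kernelP p s (x i) (x (i + 1))) *
          ∏ i ∈ Finset.range m, kernelP p 0 (y i) (y (i + 1)))

end PadicHua

end

noncomputable section

namespace PadicHua

open MeasureTheory

/-! ## Counting residue classes of approximate kernels -/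

section ResidueCount

variable {p : ℕ} [Fact p.Prime] {m n : Type*} [Fintype m] [Fintype n]

/-! The tail counts of the singular numbers have an intrinsic description. `resCount Z ρ`, the
number of residues mod `p` of integral vectors `v` with `‖Z v‖ < ρ`, is unchanged by `GL(N, ℤ_p)` on
either side, so at `ρ = p ^ i` a diagonal form gives `p` to the number of `k_j < i`
(`HasSingularNumbers.resCount_eq`). It is also locally constant in `Z`, so `Sing` is measurable.

For a Haar-random integral matrix, the numbers of singular numbers below `0, -1, -2, …` form a
`P^{(0)}`-chain started from `N`. To see this, expose the rows one at a time. A row with a unit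
entry can be moved to a coordinate form and deleted with one column; any other row is `p` times a
uniform row. Once every remaining row carries a factor `p`, the matrix is `p` times a fresh uniform
matrix of size `y 0`, which is the Markov property (`volume_chainSet`, `volume_chainSet_zero`).

If all singular numbers of `Z` are below `n`, then `Z = p^{-n} W` with `W` integral. A cylinder for
`(X, Y)` with `X_n = 0` is then a cylinder for the chain of `W`, run upwards through `N - X_n, …, N
- X_0 = Y_0` and on through `Y_1, Y_2, …`. The density is constant there, since `γ` is `p` to the
power `X_1 + ⋯ + X_n`. The reversal identity `piTilde_mul_kernelP` turns the upward `P^{(0)}`-steps,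
with density and volume factors, into `π̃` and downward `P^{(s)}`-steps
(`singularLaw_cylinder_of_eq_zero`).

Cylinders with `X_n ≠ 0` follow by summing over continuations, because the `P^{(s)}`-chain is
absorbed at `0` (`tendsto_hitZero`). Total masses come from two `q`-identities: a Durfee-type sum
for the kernels and the `q`-Vandermonde convolution for `π̃`. For the converse, the counts determine
`k`, `Δ_N` is countable, and the event that `(X, Y)` are the counts of `k` has mass `m_N^{(s)} {k}`;
these masses add up to one. -/

/-- A matrix over `ℤ_p`, viewed over `ℚ_p`. -/
def castMat {m n : Type*} (W : Matrix m n ℤ_[p]) : Matrix m n ℚ_[p] :=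
  W.map PadicInt.Coe.ringHom

theorem castMat_apply {m n : Type*} (W : Matrix m n ℤ_[p]) (i : m) (j : n) :
    castMat W i j = (W i j : ℚ_[p]) := rfl

theorem castMat_mul {l n : Type*} (A : Matrix l m ℤ_[p]) (B : Matrix m n ℤ_[p]) :
    castMat (A * B) = castMat A * castMat B :=
  Matrix.map_mul

theorem castMat_one {n : Type*} [DecidableEq n] : castMat (1 : Matrix n n ℤ_[p]) = 1 :=
  Matrix.map_one _ (map_zero _) (map_one _)

theorem norm_sum_lt {ι : Type*} (s : Finset ι) (f : ι → ℚ_[p]) {ρ : ℝ} (hρ : 0 < ρ)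
    (h : ∀ i ∈ s, ‖f i‖ < ρ) : ‖∑ i ∈ s, f i‖ < ρ := by
  refine Finset.sum_induction f (fun x => ‖x‖ < ρ) (fun a b ha hb => ?_) (by simpa) h
  exact (IsUltrametricDist.norm_add_le_max a b).trans_lt (max_lt ha hb)

theorem toZMod_eq_zero_iff (x : ℤ_[p]) : PadicInt.toZMod x = 0 ↔ ‖x‖ < 1 := by
  rw [← RingHom.mem_ker, PadicInt.ker_toZMod, IsLocalRing.mem_maximalIdeal,
    PadicInt.mem_nonunits]

/-- The residues modulo `p` of the integral vectors `v` with `‖Z v‖ < ρ` entrywise. -/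
def smallRes {m : Type*} (Z : Matrix m n ℚ_[p]) (ρ : ℝ) : Set (n → ZMod p) :=
  {u | ∃ v : n → ℤ_[p], (∀ j, PadicInt.toZMod (v j) = u j) ∧
    ∀ i, ‖∑ j, Z i j * (v j : ℚ_[p])‖ < ρ}

/-- The number of residues modulo `p` of the integral vectors `v` with `‖Z v‖ < ρ` entrywise. -/
def resCount {m : Type*} (Z : Matrix m n ℚ_[p]) (ρ : ℝ) : ℕ :=
  (smallRes Z ρ).ncard

/-- By the ultrametric inequality an integral `B` does not increase the sup norm, so the same `v` is
a witness. -/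
theorem smallRes_subset_left_mul {l : Type*} (B : Matrix l m ℤ_[p]) (Z : Matrix m n ℚ_[p]) {ρ : ℝ}
    (hρ : 0 < ρ) : smallRes Z ρ ⊆ smallRes (castMat B * Z) ρ := by
  rintro u ⟨v, hv, h⟩
  refine ⟨v, hv, fun i => ?_⟩
  have : ∑ j, (castMat B * Z) i j * (v j : ℚ_[p]) =
      ∑ k, (B i k : ℚ_[p]) * ∑ j, Z k j * (v j : ℚ_[p]) := by
    simp_rw [Matrix.mul_apply, Finset.sum_mul, Finset.mul_sum]
    rw [Finset.sum_comm]
    simp only [castMat_apply, mul_assoc]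
  rw [this]
  refine norm_sum_lt _ _ hρ fun k _ => ?_
  rw [norm_mul]
  exact (mul_le_of_le_one_left (norm_nonneg _) (PadicInt.norm_le_one _)).trans_lt (h k)

theorem resCount_left_mul [DecidableEq m] (B : (Matrix m m ℤ_[p])ˣ) (Z : Matrix m n ℚ_[p]) {ρ : ℝ}
    (hρ : 0 < ρ) : resCount (castMat (B : Matrix m m ℤ_[p]) * Z) ρ = resCount Z ρ := by
  unfold resCount
  congr 1
  refine (smallRes_subset_left_mul _ Z hρ).antisymm' ?_
  have := smallRes_subset_left_mul ((B⁻¹ : (Matrix m m ℤ_[p])ˣ) : Matrix m m ℤ_[p])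
    (castMat (B : Matrix m m ℤ_[p]) * Z) hρ
  rwa [← Matrix.mul_assoc, ← castMat_mul, Units.inv_mul, castMat_one, Matrix.one_mul] at this

/-- The substitution `v ↦ C v` acts on residues through `C` mod `p`, which is invertible and hence
injective. -/
theorem resCount_right_mul_le {m : Type*} [DecidableEq n] (Z : Matrix m n ℚ_[p])
    (C : (Matrix n n ℤ_[p])ˣ) (ρ : ℝ) :
    resCount (Z * castMat (C : Matrix n n ℤ_[p])) ρ ≤ resCount Z ρ := by
  set C' : Matrix n n (ZMod p) := PadicInt.toZMod.mapMatrix (C : Matrix n n ℤ_[p]) with hC'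
  have hinv : PadicInt.toZMod.mapMatrix ((C⁻¹ : (Matrix n n ℤ_[p])ˣ) : Matrix n n ℤ_[p]) * C' = 1 := by
    rw [hC', ← map_mul, Units.inv_mul, map_one]
  refine Set.ncard_le_ncard_of_injOn (fun u => C'.mulVec u) ?_ ?_ (Set.toFinite _)
  · rintro u ⟨v, hv, h⟩
    refine ⟨(C : Matrix n n ℤ_[p]).mulVec v, fun j => ?_, fun i => ?_⟩
    · simp only [Matrix.mulVec, dotProduct, map_sum, map_mul, hv]
      rfl
    · convert h i using 2
      simp only [Matrix.mulVec, dotProduct, Matrix.mul_apply, Finset.sum_mul, PadicInt.coe_sum,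
        PadicInt.coe_mul, Finset.mul_sum, castMat_apply, mul_assoc]
      rw [Finset.sum_comm]
  · intro u _ u' _ huu
    have := congrArg (fun w => (PadicInt.toZMod.mapMatrix
      ((C⁻¹ : (Matrix n n ℤ_[p])ˣ) : Matrix n n ℤ_[p])).mulVec w) huu
    simpa only [Matrix.mulVec_mulVec, hinv, Matrix.one_mulVec] using this

theorem resCount_right_mul {m : Type*} [DecidableEq n] (Z : Matrix m n ℚ_[p])
    (C : (Matrix n n ℤ_[p])ˣ) (ρ : ℝ) :
    resCount (Z * castMat (C : Matrix n n ℤ_[p])) ρ = resCount Z ρ := by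
  refine (resCount_right_mul_le Z C ρ).antisymm ?_
  have := resCount_right_mul_le (Z * castMat (C : Matrix n n ℤ_[p])) C⁻¹ ρ
  rwa [Matrix.mul_assoc, ← castMat_mul, Units.mul_inv, castMat_one, Matrix.mul_one] at this

/-- An entrywise perturbation below `ρ` moves `Z v` by less than `ρ` for integral `v`. This is the
source of local constancy, and so of all measurability below. -/
theorem smallRes_congr {m : Type*} {Z Z' : Matrix m n ℚ_[p]} {ρ : ℝ} (hρ : 0 < ρ)
    (h : ∀ i j, ‖Z i j - Z' i j‖ < ρ) : smallRes Z ρ = smallRes Z' ρ := by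
  have key : ∀ Z Z' : Matrix m n ℚ_[p], (∀ i j, ‖Z i j - Z' i j‖ < ρ) →
      smallRes Z' ρ ⊆ smallRes Z ρ := by
    rintro Z Z' h u ⟨v, hv, hz⟩
    refine ⟨v, hv, fun i => ?_⟩
    have : ∑ j, Z i j * (v j : ℚ_[p]) =
        ∑ j, (Z i j - Z' i j) * (v j : ℚ_[p]) + ∑ j, Z' i j * (v j : ℚ_[p]) := by
      rw [← Finset.sum_add_distrib]
      exact Finset.sum_congr rfl fun j _ => by ring
    rw [this]
    refine (IsUltrametricDist.norm_add_le_max _ _).trans_lt (max_lt ?_ (hz i))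
    refine norm_sum_lt _ _ hρ fun j _ => ?_
    rw [norm_mul]
    exact (mul_le_of_le_one_right (norm_nonneg _) (PadicInt.norm_le_one _)).trans_lt (h i j)
  refine (key Z' Z fun i j => ?_).antisymm (key Z Z' h)
  rw [norm_sub_rev]
  exact h i j

theorem continuous_resCount {ρ : ℝ} (hρ : 0 < ρ) :
    Continuous fun Z : Matrix m n ℚ_[p] => resCount Z ρ := by
  refine IsLocallyConstant.continuous ((IsLocallyConstant.iff_eventually_eq _).2 fun Z => ?_)
  have : ∀ i j, ∀ᶠ Z' : Matrix m n ℚ_[p] in nhds Z, ‖Z' i j - Z i j‖ < ρ := by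
    intro i j
    have hc : Continuous fun Z' : Matrix m n ℚ_[p] => ‖Z' i j - Z i j‖ := by fun_prop
    exact hc.continuousAt.eventually_lt continuousAt_const (by simpa)
  filter_upwards [Filter.eventually_all.2 fun i => Filter.eventually_all.2 (this i)] with Z' h
  exact congrArg Set.ncard (smallRes_congr hρ h)

theorem resCount_smul {m : Type*} (c : ℚ_[p]) (hc : c ≠ 0) (Z : Matrix m n ℚ_[p]) (ρ : ℝ) :
    resCount (c • Z) ρ = resCount Z (ρ / ‖c‖) := by
  unfold resCount smallRes
  congr 1
  ext u
  refine exists_congr fun v => and_congr_right fun _ => forall_congr' fun i => ?_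
  simp only [Matrix.smul_apply, smul_eq_mul, mul_assoc]
  rw [← Finset.mul_sum, norm_mul, lt_div_iff₀ (norm_pos_iff.2 hc), mul_comm]

theorem resCount_eq_pow_card {m : Type*} {Z : Matrix m n ℚ_[p]} {ρ : ℝ} (hρ : 0 < ρ)
    (h : ∀ i j, ‖Z i j‖ < ρ) : resCount Z ρ = p ^ Fintype.card n := by
  classical
  have : smallRes Z ρ = Set.univ := by
    refine Set.eq_univ_of_forall fun u => ⟨fun j => ((u j).val : ℤ_[p]), fun j => ?_, fun i => ?_⟩
    · simp
    · refine norm_sum_lt _ _ hρ fun j _ => ?_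
      rw [norm_mul]
      exact (mul_le_of_le_one_right (norm_nonneg _) (PadicInt.norm_le_one _)).trans_lt (h i j)
  rw [resCount, this, Set.ncard_univ, Nat.card_eq_fintype_card, Fintype.card_fun, ZMod.card]

/-- The conditions decouple: a coordinate with `‖d j‖ < ρ` is free, while any other one excludes
units, so its residue is `0`, realised by `v j = 0`. -/
theorem resCount_diagonal [DecidableEq n] (d : n → ℚ_[p]) {ρ : ℝ} (hρ : 0 < ρ) :
    resCount (Matrix.diagonal d) ρ = p ^ (Finset.univ.filter fun j => ‖d j‖ < ρ).card := by
  classical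
  have : smallRes (Matrix.diagonal d) ρ =
      ((Fintype.piFinset fun j => if ‖d j‖ < ρ then Finset.univ else {0} : Finset (n → ZMod p)) :
        Set (n → ZMod p)) := by
    ext u
    simp only [smallRes, Matrix.diagonal_apply, ite_mul, zero_mul, Finset.sum_ite_eq,
      Finset.mem_univ, if_true, Set.mem_ofPred_eq, Finset.mem_coe, Fintype.mem_piFinset, norm_mul]
    constructor
    · rintro ⟨v, hv, h⟩ j
      split_ifs with hj
      · exact Finset.mem_univ _
      · rw [Finset.mem_singleton, ← hv, toZMod_eq_zero_iff]
        by_contra hv1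
        have h1 : ‖(v j : ℚ_[p])‖ = 1 := le_antisymm (PadicInt.norm_le_one _) (not_lt.1 hv1)
        have := h j
        rw [h1, mul_one] at this
        exact hj this
    · intro hu
      refine ⟨fun j => if ‖d j‖ < ρ then ((u j).val : ℤ_[p]) else 0, fun j => ?_, fun j => ?_⟩
      · have := hu j
        dsimp only
        split_ifs at this ⊢ with hj
        · simp
        · rw [Finset.mem_singleton.1 this, map_zero]
      · dsimp only
        split_ifs with hj
        · exact (mul_le_of_le_one_right (norm_nonneg _) (PadicInt.norm_le_one _)).trans_lt hj
        · simpa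
  rw [resCount, this, Set.ncard_coe_finset, Fintype.card_piFinset]
  simp only [apply_ite Finset.card, Finset.card_univ, ZMod.card, Finset.card_singleton]
  rw [Finset.prod_ite]
  simp

/-- A row equal to the coordinate form `e_j` may be deleted together with the column `j`. -/
theorem resCount_insertNth_single {a : ℕ} (i j : Fin (a + 1)) (Z : Fin a → Fin (a + 1) → ℚ_[p])
    (hZ : ∀ k l, ‖Z k l‖ ≤ 1) {ρ : ℝ} (hρ : 0 < ρ) (hρ1 : ρ ≤ 1) :
    resCount (Matrix.of (i.insertNth (Pi.single j 1 : Fin (a + 1) → ℚ_[p]) Z)) ρ =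
      resCount (Matrix.of fun k l => Z k (j.succAbove l)) ρ := by
  have key : smallRes (Matrix.of (i.insertNth (Pi.single j 1 : Fin (a + 1) → ℚ_[p]) Z)) ρ =
      (fun u => j.insertNth 0 u) '' smallRes (Matrix.of fun k l => Z k (j.succAbove l)) ρ := by
    ext u
    simp only [smallRes, Set.mem_ofPred_eq, Set.mem_image, Matrix.of_apply]
    constructor
    · rintro ⟨v, hv, h⟩
      -- The row `e_j` makes `v j` small. Column `j` then contributes less than `ρ` to the other
      -- rows, and `ρ ≤ 1` forces the residue of `v j` to vanish.
      have hj : ‖(v j : ℚ_[p])‖ < ρ := by simpa [Pi.single_apply] using h i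
      refine ⟨fun l => u (j.succAbove l), ⟨fun l => v (j.succAbove l), fun l => hv _, fun k => ?_⟩,
        ?_⟩
      · have hk := h (i.succAbove k)
        rw [Fin.insertNth_apply_succAbove, Fin.sum_univ_succAbove _ j] at hk
        have h2 : ‖Z k j * (v j : ℚ_[p])‖ < ρ := by
          rw [norm_mul]
          exact (mul_le_of_le_one_left (norm_nonneg _) (hZ _ _)).trans_lt hj
        rw [← add_sub_cancel_left (Z k j * (v j : ℚ_[p]))
          (∑ l, Z k (j.succAbove l) * (v (j.succAbove l) : ℚ_[p])), sub_eq_add_neg]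
        exact (IsUltrametricDist.norm_add_le_max _ _).trans_lt (max_lt hk (by rwa [norm_neg]))
      · have h0 : u j = 0 := by
          rw [← hv, toZMod_eq_zero_iff]
          exact hj.trans_le hρ1
        rw [← h0]
        exact Fin.insertNth_self_removeNth j u
    · rintro ⟨u, ⟨v, hv, h⟩, rfl⟩
      refine ⟨j.insertNth 0 v, fun l => ?_, fun k => ?_⟩
      · cases l using Fin.succAboveCases j <;> simp [hv]
      · cases k using Fin.succAboveCases i with
        | x => simp [Pi.single_apply, hρ]
        | p k => simpa [Fin.sum_univ_succAbove _ j] using h k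
  rw [resCount, key, Set.ncard_image_of_injective _ fun u u' h => ?_, resCount]
  exact Fin.insertNth_right_injective (α := fun _ => ZMod p) (p := j) (x := 0) h

end ResidueCount

/-! ## Existence of singular numbers -/

section Smith

variable {p : ℕ} [Fact p.Prime]

theorem exists_unit_mul_primePowNeg {z : ℚ_[p]} (hz : z ≠ 0) :
    ∃ (u : ℤ_[p]) (k : WithBot ℤ), IsUnit u ∧ z = u * primePowNeg p k := by
  have hp : (p : ℚ_[p]) ≠ 0 := Nat.cast_ne_zero.2 (Fact.out : p.Prime).ne_zero
  have hu : ‖z * (p : ℚ_[p]) ^ (-z.valuation)‖ = 1 := by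
    rw [norm_mul, Padic.norm_eq_zpow_neg_valuation hz, Padic.norm_p_zpow, neg_neg, ← zpow_add₀,
      neg_add_cancel, zpow_zero]
    exact Nat.cast_ne_zero.2 (Fact.out : p.Prime).ne_zero
  refine ⟨⟨_, hu.le⟩, ((-z.valuation : ℤ) : WithBot ℤ), PadicInt.isUnit_iff.2 hu, ?_⟩
  change z = z * (p : ℚ_[p]) ^ (-z.valuation) * (p : ℚ_[p]) ^ (- -z.valuation)
  rw [mul_assoc, ← zpow_add₀ hp, add_neg_cancel, zpow_zero, mul_one]

/-- Smith normal form over `ℚ_p`, with the diagonal entries in any order. -/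
theorem exists_diagonal_form (n : ℕ) (Z : Matrix (Fin n) (Fin n) ℚ_[p]) :
    ∃ (B C : Matrix (Fin n) (Fin n) ℤ_[p]) (d : Fin n → WithBot ℤ), IsUnit B ∧ IsUnit C ∧
      Z = castMat B * Matrix.diagonal (fun j => primePowNeg p (d j)) * castMat C := by
  induction n with
  | zero => exact ⟨1, 1, fun _ => ⊥, isUnit_one, isUnit_one, Subsingleton.elim _ _⟩
  | succ n ih =>
    by_cases hZ : Z = 0
    · refine ⟨1, 1, fun _ => ⊥, isUnit_one, isUnit_one, ?_⟩
      have : Matrix.diagonal (fun _ : Fin (n + 1) => primePowNeg p ⊥) = 0 :=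
        Matrix.diagonal_zero
      rw [hZ, this, Matrix.mul_zero, Matrix.zero_mul]
    -- A pivot of maximal norm makes all quotients `z⁻¹ * Z i j` integral, so row and column
    -- elimination stays over `ℤ_p`.
    obtain ⟨⟨i₀, j₀⟩, -, hmax⟩ := Finset.exists_max_image Finset.univ
      (fun ij : Fin (n + 1) × Fin (n + 1) => ‖Z ij.1 ij.2‖) ⟨(0, 0), Finset.mem_univ _⟩
    set z := Z i₀ j₀ with hz
    have hz0 : z ≠ 0 := by
      intro h0
      refine hZ (Matrix.ext fun i j => norm_le_zero_iff.1 ?_)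
      have := hmax (i, j) (Finset.mem_univ _)
      simpa only [← hz, h0, norm_zero] using this
    have hle : ∀ i j, ‖z⁻¹ * Z i j‖ ≤ 1 := fun i j => by
      rw [norm_mul, norm_inv, inv_mul_le_iff₀ (norm_pos_iff.2 hz0), mul_one]
      exact hmax (i, j) (Finset.mem_univ _)
    obtain ⟨u, k, hu, huk⟩ := exists_unit_mul_primePowNeg hz0
    set er : Fin (n + 1) ≃ Fin n ⊕ Unit := (finSuccEquiv' i₀).trans (Equiv.optionEquivSumPUnit _)
    set ec : Fin (n + 1) ≃ Fin n ⊕ Unit := (finSuccEquiv' j₀).trans (Equiv.optionEquivSumPUnit _)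
    have her : er.symm (Sum.inr ()) = i₀ := by simp [er]
    have hec : ec.symm (Sum.inr ()) = j₀ := by simp [ec]
    set M := Z.submatrix er.symm ec.symm with hM
    have hMz : M (Sum.inr ()) (Sum.inr ()) = z := by rw [hM, Matrix.submatrix_apply, her, hec]
    -- The induction hypothesis is applied to the Schur complement of the pivot.
    obtain ⟨B₁, C₁, d₁, hB, hC, h⟩ := ih (Matrix.of fun i j => M (Sum.inl i) (Sum.inl j) -
      M (Sum.inl i) (Sum.inr ()) * (z⁻¹ * M (Sum.inr ()) (Sum.inl j)))
    let b : Matrix (Fin n) Unit ℤ_[p] := Matrix.of fun i _ => ⟨z⁻¹ * M (Sum.inl i) (Sum.inr ()), hle _ _⟩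
    let c : Matrix Unit (Fin n) ℤ_[p] := Matrix.of fun _ j => ⟨z⁻¹ * M (Sum.inr ()) (Sum.inl j), hle _ _⟩
    let U : Matrix Unit Unit ℤ_[p] := Matrix.of fun _ _ => u
    let L : Matrix (Fin n ⊕ Unit) (Fin n ⊕ Unit) ℤ_[p] :=
      Matrix.fromBlocks 1 b 0 1 * Matrix.fromBlocks B₁ 0 0 U
    let R : Matrix (Fin n ⊕ Unit) (Fin n ⊕ Unit) ℤ_[p] :=
      Matrix.fromBlocks C₁ 0 0 1 * Matrix.fromBlocks 1 0 c 1
    have hL : IsUnit L := by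
      rw [Matrix.isUnit_iff_isUnit_det] at hB ⊢
      simp [L, Matrix.det_fromBlocks_zero₂₁, U, hB, hu]
    have hR : IsUnit R := by
      rw [Matrix.isUnit_iff_isUnit_det] at hC ⊢
      simp [R, hC]
    let d : Fin n ⊕ Unit → WithBot ℤ := Sum.elim d₁ fun _ => k
    have hMeq : M = castMat L * Matrix.diagonal (fun j => primePowNeg p (d j)) * castMat R := by
      have hcast : ∀ {m₁ m₂ n₁ n₂ : Type} (A : Matrix m₁ n₁ ℤ_[p]) (B : Matrix m₁ n₂ ℤ_[p])
          (C : Matrix m₂ n₁ ℤ_[p]) (D : Matrix m₂ n₂ ℤ_[p]),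
          castMat (Matrix.fromBlocks A B C D) =
            Matrix.fromBlocks (castMat A) (castMat B) (castMat C) (castMat D) :=
        fun A B C D => Matrix.fromBlocks_map A B C D _
      have h0 : ∀ {m₁ n₁ : Type}, castMat (0 : Matrix m₁ n₁ ℤ_[p]) = 0 :=
        Matrix.map_zero _ (map_zero _)
      have hdiag : Matrix.diagonal (fun j => primePowNeg p (d j)) = Matrix.fromBlocks
          (Matrix.diagonal fun j => primePowNeg p (d₁ j)) 0 0
          (Matrix.diagonal fun _ : Unit => primePowNeg p k) := by
        rw [Matrix.fromBlocks_diagonal]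
        congr 1
        ext (j | j) <;> rfl
      have hUD : castMat U * Matrix.diagonal (fun _ : Unit => primePowNeg p k) =
          Matrix.of fun _ _ => z := by
        ext
        simp [U, castMat_apply, huk]
      rw [castMat_mul, castMat_mul, hcast, hcast, hcast, hcast, hdiag, h0, h0, castMat_one,
        castMat_one]
      have hmid : Matrix.fromBlocks (castMat B₁) 0 0 (castMat U) *
          Matrix.fromBlocks (Matrix.diagonal fun j => primePowNeg p (d₁ j)) 0 0
            (Matrix.diagonal fun _ : Unit => primePowNeg p k) *
          Matrix.fromBlocks (castMat C₁) 0 0 1 = Matrix.fromBlocks (Matrix.of fun i j =>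
            M (Sum.inl i) (Sum.inl j) -
              M (Sum.inl i) (Sum.inr ()) * (z⁻¹ * M (Sum.inr ()) (Sum.inl j))) 0 0
            (Matrix.of fun _ _ => z) := by
        simp only [Matrix.fromBlocks_multiply, Matrix.mul_zero, Matrix.zero_mul, add_zero,
          zero_add, Matrix.mul_one, h, hUD]
      rw [show ∀ F₁ F₂ D F₃ F₄ : Matrix (Fin n ⊕ Unit) (Fin n ⊕ Unit) ℚ_[p],
          F₁ * F₂ * D * (F₃ * F₄) = F₁ * (F₂ * D * F₃) * F₄ from fun _ _ _ _ _ => by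
        simp only [Matrix.mul_assoc], hmid]
      simp only [Matrix.fromBlocks_multiply, Matrix.mul_zero, Matrix.zero_mul, add_zero, zero_add,
        Matrix.one_mul, Matrix.mul_one]
      have hb : ∀ i x, castMat b i x = z⁻¹ * M (Sum.inl i) (Sum.inr ()) := fun _ _ => rfl
      have hc : ∀ x j, castMat c x j = z⁻¹ * M (Sum.inr ()) (Sum.inl j) := fun _ _ => rfl
      ext (i | i) (j | j)
      · simp only [Matrix.fromBlocks_apply₁₁, Matrix.add_apply, Matrix.mul_apply, Matrix.of_apply,
          Finset.univ_unique, Finset.sum_singleton, hb, hc]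
        field_simp
        ring
      · simp only [Matrix.fromBlocks_apply₁₂, Matrix.mul_apply, Matrix.of_apply,
          Finset.univ_unique, Finset.sum_singleton, hb]
        field_simp
      · simp only [Matrix.fromBlocks_apply₂₁, Matrix.mul_apply, Matrix.of_apply,
          Finset.univ_unique, Finset.sum_singleton, hc]
        field_simp
      · simp [hMz]
    refine ⟨L.submatrix er er, R.submatrix er ec, d ∘ er, (Matrix.isUnit_submatrix_equiv _ _).2 hL,
      (Matrix.isUnit_submatrix_equiv _ _).2 hR, ?_⟩
    have hZM : Z = M.submatrix er ec := by
      ext i j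
      simp [M]
    rw [hZM, hMeq, ← Matrix.submatrix_mul_equiv _ _ er er ec, ← Matrix.submatrix_mul_equiv _ _ er er er]
    congr 2
    exact Matrix.submatrix_diagonal_equiv _ er

theorem exists_hasSingularNumbers {N : ℕ} (Z : Matrix (Fin N) (Fin N) ℚ_[p]) :
    ∃ k : Delta N, HasSingularNumbers Z k := by
  obtain ⟨B, C, d, hB, hC, h⟩ := exists_diagonal_form N Z
  -- Sorting in the order dual puts the exponents in decreasing order; the permutation is absorbed
  -- into the columns of `B` and the rows of `C`.
  let σ : Equiv.Perm (Fin N) := Tuple.sort fun j => OrderDual.toDual (d j)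
  refine ⟨⟨fun j => d (σ j), fun i j hij =>
    Tuple.monotone_sort (fun j => OrderDual.toDual (d j)) hij⟩,
    ((Matrix.isUnit_submatrix_equiv (Equiv.refl _) σ).2 hB).unit,
    ((Matrix.isUnit_submatrix_equiv σ (Equiv.refl _)).2 hC).unit, ?_⟩
  have hd : Matrix.diagonal (fun j => primePowNeg p (d (σ j))) =
      (Matrix.diagonal fun j => primePowNeg p (d j)).submatrix σ σ :=
    (Matrix.submatrix_diagonal_equiv (fun j => primePowNeg p (d j)) σ).symm
  have hB' : (B.submatrix (Equiv.refl _) σ).map (fun a : ℤ_[p] => (a : ℚ_[p])) =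
      (castMat B).submatrix (Equiv.refl _) σ := rfl
  have hC' : (C.submatrix σ (Equiv.refl _)).map (fun a : ℤ_[p] => (a : ℚ_[p])) =
      (castMat C).submatrix σ (Equiv.refl _) := rfl
  simp only [IsUnit.unit_spec]
  rw [hd, hB', hC', Matrix.submatrix_mul_equiv, Matrix.submatrix_mul_equiv, ← h]
  rfl

theorem hasSingularNumbers_sing {N : ℕ} (Z : Matrix (Fin N) (Fin N) ℚ_[p]) :
    HasSingularNumbers Z (Sing Z) :=
  Classical.epsilon_spec (exists_hasSingularNumbers Z)

theorem norm_primePowNeg_lt_iff (k : WithBot ℤ) (i : ℤ) :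
    ‖primePowNeg p k‖ < (p : ℝ) ^ i ↔ k < (i : WithBot ℤ) := by
  have hp : 1 < (p : ℝ) := Nat.one_lt_cast.2 (Fact.out : p.Prime).one_lt
  cases k with
  | bot => simpa [primePowNeg] using zpow_pos (zero_lt_one.trans hp) i
  | coe k =>
    change ‖(p : ℚ_[p]) ^ (-k)‖ < _ ↔ _
    rw [Padic.norm_p_zpow, neg_neg, WithBot.coe_lt_coe]
    exact zpow_lt_zpow_iff_right₀ hp

/-- The left side does not mention `k`, so every decomposition of `Z` has the same tail counts. -/
theorem HasSingularNumbers.resCount_eq {N : ℕ} {Z : Matrix (Fin N) (Fin N) ℚ_[p]} {k : Delta N}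
    (h : HasSingularNumbers Z k) (i : ℤ) : resCount Z ((p : ℝ) ^ i) = p ^ (N - tailSum k i) := by
  obtain ⟨B, C, rfl⟩ := h
  have hp : 0 < (p : ℝ) ^ i := zpow_pos (Nat.cast_pos.2 (Fact.out : p.Prime).pos) i
  change resCount (castMat (B : Matrix (Fin N) (Fin N) ℤ_[p]) * _ *
    castMat (C : Matrix (Fin N) (Fin N) ℤ_[p])) _ = _
  rw [resCount_right_mul, resCount_left_mul _ _ hp, resCount_diagonal _ hp, tailSum_eq_card]
  congr 1
  simp only [norm_primePowNeg_lt_iff]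
  simp only [← not_le]
  rw [Finset.filter_not, Finset.card_sdiff_of_subset (Finset.filter_subset _ _), Finset.card_univ,
    Fintype.card_fin]

theorem resCount_eq_sing {N : ℕ} (Z : Matrix (Fin N) (Fin N) ℚ_[p]) (i : ℤ) :
    resCount Z ((p : ℝ) ^ i) = p ^ (N - tailSum (Sing Z) i) :=
  (hasSingularNumbers_sing Z).resCount_eq i

theorem tailSum_sing_eq_iff {N : ℕ} (Z : Matrix (Fin N) (Fin N) ℚ_[p]) (i : ℤ) {y : ℕ} :
    N - tailSum (Sing Z) i = y ↔ resCount Z ((p : ℝ) ^ i) = p ^ y := by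
  rw [resCount_eq_sing]
  exact (Nat.pow_right_injective (Fact.out : p.Prime).two_le).eq_iff.symm

end Smith

/-! ## Elements of `Δ_N` and their counts -/

section Counts

variable {N : ℕ}

theorem tailSum_antitone (k : Delta N) : Antitone (tailSum k) := by
  intro i j hij
  rw [tailSum_eq_card, tailSum_eq_card]
  exact Finset.card_le_card fun a ha => by
    simp only [Finset.mem_filter, Finset.mem_univ, true_and] at ha ⊢
    exact (WithBot.coe_le_coe.2 hij).trans ha

/-- Since `k` is decreasing, the indices with entry at least `i` form an initial segment of length
`tailSum k i`. Hence the tail counts determine `k`. -/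
theorem le_apply_iff_lt_tailSum (k : Delta N) (i : ℤ) (a : Fin N) :
    (i : WithBot ℤ) ≤ k.1 a ↔ (a : ℕ) < tailSum k i := by
  rw [tailSum_eq_card]
  constructor
  · intro h
    have : (Finset.Iic a) ⊆ Finset.univ.filter fun j : Fin N => (i : WithBot ℤ) ≤ k.1 j :=
      fun b hb => Finset.mem_filter.2 ⟨Finset.mem_univ _, h.trans (k.2 (Finset.mem_Iic.1 hb))⟩
    have := Finset.card_le_card this
    rw [Fin.card_Iic] at this
    omega
  · intro h
    by_contra hlt
    have : (Finset.univ.filter fun j : Fin N => (i : WithBot ℤ) ≤ k.1 j) ⊆ Finset.Iio a := by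
      intro b hb
      rw [Finset.mem_Iio]
      by_contra hab
      exact hlt ((Finset.mem_filter.1 hb).2.trans (k.2 (not_lt.1 hab)))
    have := Finset.card_le_card this
    rw [Fin.card_Iio] at this
    omega

theorem eq_of_tailSum_eq {k k' : Delta N} (h : ∀ i, tailSum k i = tailSum k' i) : k = k' := by
  have key : ∀ (a : Fin N) (i : ℤ), (i : WithBot ℤ) ≤ k.1 a ↔ (i : WithBot ℤ) ≤ k'.1 a := by
    intro a i
    rw [le_apply_iff_lt_tailSum, le_apply_iff_lt_tailSum, h]
  refine Subtype.ext (funext fun a => le_antisymm ?_ ?_)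
  · cases hk : k.1 a with
    | bot => exact bot_le
    | coe i => exact (key a i).1 hk.ge
  · cases hk : k'.1 a with
    | bot => exact bot_le
    | coe i => exact (key a i).2 hk.ge

theorem exists_tailSum_eq_zero (k : Delta N) : ∃ n : ℕ, tailSum k n = 0 := by
  -- The default `0` for entries `-∞` can only raise the bound.
  obtain ⟨M, hM⟩ := (Finset.univ.image fun a => (k.1 a).unbotD 0).exists_le
  refine ⟨M.toNat + 1, ?_⟩
  rw [tailSum_eq_card, Finset.card_eq_zero, Finset.filter_eq_empty_iff]
  intro a _ ha
  have hle := hM _ (Finset.mem_image_of_mem (fun a => (k.1 a).unbotD 0) (Finset.mem_univ a))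
  cases hk : k.1 a with
  | bot => simp [hk] at ha
  | coe z =>
    rw [hk, WithBot.coe_le_coe] at ha
    simp only [hk, WithBot.unbotD_coe] at hle
    push_cast at ha
    omega

instance instCountableDelta : Countable (Delta N) :=
  inferInstanceAs (Countable {k : Fin N → WithBot ℤ // Antitone k})

/-- Conjugation of partitions: the sum of the positive entries equals the sum over `i ≥ 1` of the
number of entries at least `i`. Thus `γ` is a function of `X_1, X_2, …`. -/
theorem prod_posPow_eq {p : ℕ} (k : Delta N) (n : ℕ) (hn : tailSum k n = 0) :
    ∏ j, posPow p (k.1 j) = (p : ℝ) ^ ∑ i ∈ Finset.range n, tailSum k (i + 1) := by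
  have hpos : ∀ a : Fin N, posPow p (k.1 a) =
      (p : ℝ) ^ ∑ i ∈ Finset.range n, if (((i : ℤ) + 1 : ℤ) : WithBot ℤ) ≤ k.1 a then 1 else 0 := by
    intro a
    have hlt : ¬ (((n : ℤ) : WithBot ℤ) ≤ k.1 a) := by
      rw [le_apply_iff_lt_tailSum, hn]
      exact Nat.not_lt_zero _
    cases hk : k.1 a with
    | bot => simp [posPow]
    | coe z =>
      rw [hk, WithBot.coe_le_coe] at hlt
      simp only [WithBot.coe_le_coe]
      rw [← Finset.card_filter]
      have : (Finset.range n).filter (fun i : ℕ => (i : ℤ) + 1 ≤ z) = Finset.range z.toNat := by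
        ext i
        simp only [Finset.mem_filter, Finset.mem_range]
        omega
      rw [this, Finset.card_range]
      change (if 0 < z then (p : ℝ) ^ z else 1) = _
      split_ifs with hz
      · rw [← zpow_natCast, Int.toNat_of_nonneg hz.le]
      · rw [Int.toNat_of_nonpos (not_lt.1 hz), pow_zero]
  rw [Finset.prod_congr rfl fun a _ => hpos a, Finset.prod_pow_eq_pow_sum, Finset.sum_comm]
  simp only [tailSum_eq_card, Finset.card_filter]

end Counts

/-! ## Haar measure on integral vectors and matrices -/

section Haar

/-- Haar measures transform by a constant factor under open embeddings of a compact group. -/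
theorem addHaar_image {G H : Type*} [AddCommGroup G] [TopologicalSpace G] [IsTopologicalAddGroup G]
    [CompactSpace G] [MeasurableSpace G] [BorelSpace G] [AddCommGroup H] [TopologicalSpace H]
    [IsTopologicalAddGroup H] [MeasurableSpace H] [BorelSpace H]
    (μ : Measure G) [μ.IsAddHaarMeasure] [IsProbabilityMeasure μ] (ν : Measure H)
    [ν.IsAddHaarMeasure] (φ : G →+ H) (hφ : Topology.IsOpenEmbedding φ) (S : Set G) :
    ν (φ '' S) = ν (Set.range φ) * μ S := by
  -- The pullback of `ν` is a Haar measure on a compact group, hence a multiple of `μ`; its total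
  -- mass identifies the factor.
  have : (ν.comap φ).IsAddHaarMeasure := Measure.IsAddHaarMeasure.comap (mH := inferInstance) ν hφ
  have h := Measure.isAddInvariant_eq_smul_of_compactSpace (ν.comap φ) μ
  have hS : ∀ S : Set G, ν (φ '' S) = Measure.addHaarScalarFactor (ν.comap φ) μ • μ S := by
    intro S
    rw [← hφ.measurableEmbedding.comap_apply]
    conv_lhs => rw [h]
    rfl
  rw [hS, ← Set.image_univ, hS, measure_univ, smul_mul_assoc, one_mul]

variable {p : ℕ} [Fact p.Prime]

instance instMeasurableSpacePadicInt : MeasurableSpace ℤ_[p] := borel _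

instance instBorelSpacePadicInt : BorelSpace ℤ_[p] := ⟨rfl⟩

/-- The volume on `ℤ_p` is the Haar probability measure. -/
instance instMeasureSpacePadicInt : MeasureSpace ℤ_[p] :=
  ⟨Measure.addHaarMeasure ⊤⟩

instance instIsAddHaarMeasurePadicInt : (volume : Measure ℤ_[p]).IsAddHaarMeasure :=
  Measure.isAddHaarMeasure_addHaarMeasure ⊤

instance instIsProbabilityMeasurePadicInt : IsProbabilityMeasure (volume : Measure ℤ_[p]) :=
  ⟨Measure.addHaarMeasure_self⟩

/-- The ball is the kernel of reduction mod `p ^ n`, a subgroup of index `p ^ n` in a group of mass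
one. -/
theorem volume_closedBall_padicInt (n : ℕ) :
    volume {x : ℤ_[p] | ‖x‖ ≤ (p : ℝ) ^ (-n : ℤ)} = ((p : ENNReal) ^ n)⁻¹ := by
  have hp : p ≠ 0 := (Fact.out : p.Prime).ne_zero
  have : NeZero (p ^ n) := ⟨pow_ne_zero n hp⟩
  let f : ℤ_[p] →+ ZMod (p ^ n) := (PadicInt.toZModPow n).toAddMonoidHom
  have hf : Function.Surjective f := ZMod.ringHom_surjective (PadicInt.toZModPow n)
  have hker : (f.ker : Set ℤ_[p]) = {x : ℤ_[p] | ‖x‖ ≤ (p : ℝ) ^ (-n : ℤ)} := by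
    ext x
    change PadicInt.toZModPow n x = 0 ↔ _
    rw [← RingHom.mem_ker, PadicInt.ker_toZModPow]
    exact (PadicInt.norm_le_pow_iff_mem_span_pow x n).symm
  have hidx : f.ker.index = p ^ n := by
    rw [AddSubgroup.index_ker, AddMonoidHom.range_eq_top.2 hf]
    simp
  have : f.ker.FiniteIndex := ⟨by rw [hidx]; exact pow_ne_zero n hp⟩
  have h := AddSubgroup.index_mul_measure f.ker
    (by rw [hker]; exact (isClosed_le continuous_norm continuous_const).measurableSet)
    (volume : Measure ℤ_[p])
  rw [hidx, hker, measure_univ, Nat.cast_pow] at h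
  exact ENNReal.eq_inv_of_mul_eq_one_left (by rw [mul_comm]; exact h)

/-- Multiplication by `p` on integral vectors. -/
def mulP (p : ℕ) [Fact p.Prime] (c : ℕ) : (Fin c → ℤ_[p]) →+ (Fin c → ℤ_[p]) where
  toFun r j := p * r j
  map_zero' := by ext; simp
  map_add' r r' := by ext; simp [mul_add]

theorem range_mulP (c : ℕ) : Set.range (mulP p c) = Set.univ.pi fun _ => {x : ℤ_[p] | ‖x‖ < 1} := by
  ext r
  simp only [Set.mem_range, Set.mem_pi, Set.mem_univ, true_implies, Set.mem_ofPred_eq]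
  constructor
  · rintro ⟨r, rfl⟩ j
    exact (PadicInt.norm_lt_one_iff_dvd _).2 (dvd_mul_right _ _)
  · intro h
    choose r' hr' using fun j => (PadicInt.norm_lt_one_iff_dvd _).1 (h j)
    exact ⟨r', funext fun j => (hr' j).symm⟩

theorem isOpenEmbedding_mulP (c : ℕ) : Topology.IsOpenEmbedding (mulP p c) := by
  have hc : Continuous (mulP p c) := continuous_pi fun j => by
    change Continuous fun r : Fin c → ℤ_[p] => (p : ℤ_[p]) * r j
    fun_prop
  have hp : (p : ℤ_[p]) ≠ 0 := Nat.cast_ne_zero.2 (Fact.out : p.Prime).ne_zero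
  have hinj : Function.Injective (mulP p c) := fun r r' h => funext fun j =>
    mul_left_cancel₀ hp (congrFun h j)
  refine ⟨(hc.isClosedEmbedding hinj).isEmbedding, ?_⟩
  rw [range_mulP]
  exact isOpen_set_pi Set.finite_univ fun _ _ => isOpen_lt continuous_norm continuous_const

theorem volume_range_mulP (c : ℕ) : volume (Set.range (mulP p c)) = ((p : ENNReal) ^ c)⁻¹ := by
  have h : {x : ℤ_[p] | ‖x‖ < 1} = {x : ℤ_[p] | ‖x‖ ≤ (p : ℝ) ^ (-(1 : ℕ) : ℤ)} := by
    ext x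
    have := PadicInt.norm_le_pow_iff_norm_lt_pow_add_one x (-(1 : ℕ) : ℤ)
    simp only [Set.mem_ofPred_eq]
    rw [this]
    simp
  rw [range_mulP, volume_pi_pi, h, volume_closedBall_padicInt, Finset.prod_const, Finset.card_univ,
    Fintype.card_fin, pow_one, ENNReal.inv_pow]

theorem volume_image_mulP (c : ℕ) (S : Set (Fin c → ℤ_[p])) :
    volume (mulP p c '' S) = ((p : ENNReal) ^ c)⁻¹ * volume S := by
  rw [addHaar_image volume volume _ (isOpenEmbedding_mulP c), volume_range_mulP]

/-- The integral matrix `W`, scaled by `p^{-n}`. -/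
def scaledCast (p : ℕ) [Fact p.Prime] (N n : ℕ) :
    (Fin N → Fin N → ℤ_[p]) →+ Matrix (Fin N) (Fin N) ℚ_[p] where
  toFun W := ((p : ℚ_[p]) ^ n)⁻¹ • castMat (Matrix.of W)
  map_zero' := by ext; simp [castMat_apply]
  map_add' W W' := by ext; simp [castMat_apply, mul_add]

theorem scaledCast_apply (N n : ℕ) (W : Fin N → Fin N → ℤ_[p]) :
    scaledCast p N n W = ((p : ℚ_[p]) ^ n)⁻¹ • castMat (Matrix.of W) := rfl

theorem natCast_p_ne_zero : (p : ℚ_[p]) ≠ 0 := Nat.cast_ne_zero.2 (Fact.out : p.Prime).ne_zero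

theorem norm_scaledCast (N n : ℕ) (W : Fin N → Fin N → ℤ_[p]) (i j : Fin N) :
    ‖scaledCast p N n W i j‖ = (p : ℝ) ^ n * ‖W i j‖ := by
  rw [scaledCast_apply, Matrix.smul_apply, smul_eq_mul, norm_mul, norm_inv, norm_pow,
    Padic.norm_p, inv_pow, inv_inv]
  rfl

theorem range_scaledCast (N n : ℕ) :
    Set.range (scaledCast p N n) = {Z | ∀ i j, ‖Z i j‖ ≤ (p : ℝ) ^ n} := by
  have hp : (0 : ℝ) < (p : ℝ) ^ n := pow_pos (Nat.cast_pos.2 (Fact.out : p.Prime).pos) n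
  have hpn : ((p : ℚ_[p]) ^ n) ≠ 0 := pow_ne_zero n natCast_p_ne_zero
  ext Z
  constructor
  · rintro ⟨W, rfl⟩ i j
    rw [norm_scaledCast]
    exact mul_le_of_le_one_right hp.le (PadicInt.norm_le_one _)
  · intro h
    refine ⟨fun i j => ⟨(p : ℚ_[p]) ^ n * Z i j, ?_⟩, ?_⟩
    · rw [norm_mul, norm_pow, Padic.norm_p, inv_pow, inv_mul_le_iff₀ hp, mul_one]
      exact h i j
    · ext i j
      change ((p : ℚ_[p]) ^ n)⁻¹ * ((p : ℚ_[p]) ^ n * Z i j) = Z i j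
      rw [inv_mul_cancel_left₀ hpn]

theorem isOpenEmbedding_scaledCast (N n : ℕ) : Topology.IsOpenEmbedding (scaledCast p N n) := by
  have hpn : ((p : ℚ_[p]) ^ n)⁻¹ ≠ 0 := inv_ne_zero (pow_ne_zero n natCast_p_ne_zero)
  have h1 : Topology.IsOpenEmbedding
      (Pi.map fun _ : Fin N => Pi.map fun _ : Fin N => ((↑) : ℤ_[p] → ℚ_[p])) :=
    .piMap fun _ => .piMap fun _ => PadicInt.isOpenEmbedding_coe
  exact (Homeomorph.smulOfNeZero (α := Matrix (Fin N) (Fin N) ℚ_[p]) _ hpn).isOpenEmbedding.comp h1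

instance instIsAddHaarMeasureVol (N : ℕ) : (vol p N).IsAddHaarMeasure :=
  Measure.isAddHaarMeasure_addHaarMeasure _

/-- The scaling constant is found on one test set: the integral matrices divisible by `p ^ n` are
mapped onto `Mat(N, ℤ_p)`, which has volume one. -/
theorem vol_range_scaledCast (N n : ℕ) :
    vol p N (Set.range (scaledCast p N n)) = (p : ENNReal) ^ (n * (N * N)) := by
  have hp : (0 : ℝ) < (p : ℝ) ^ n := pow_pos (Nat.cast_pos.2 (Fact.out : p.Prime).pos) n
  set S : Set (Fin N → Fin N → ℤ_[p]) :=
    Set.univ.pi fun _ => Set.univ.pi fun _ => {x : ℤ_[p] | ‖x‖ ≤ (p : ℝ) ^ (-n : ℤ)} with hS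
  have hvS : volume S = ((p : ENNReal) ^ (n * (N * N)))⁻¹ := by
    simp only [hS, volume_pi_pi, volume_closedBall_padicInt, Finset.prod_const, Finset.card_univ,
      Fintype.card_fin, ← ENNReal.inv_pow, ← pow_mul, mul_assoc]
  have himg : scaledCast p N n '' S = integerMatrices p N := by
    have hmem : ∀ W, W ∈ S ↔ scaledCast p N n W ∈ integerMatrices p N := by
      intro W
      simp only [hS, Set.mem_pi, Set.mem_univ, true_implies, Set.mem_ofPred_eq, integerMatrices]
      refine forall_congr' fun i => forall_congr' fun j => ?_
      rw [norm_scaledCast, zpow_neg, zpow_natCast, ← one_div, le_div_iff₀ hp, mul_comm]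
    ext Z
    constructor
    · rintro ⟨W, hW, rfl⟩
      exact (hmem W).1 hW
    · intro hZ
      obtain ⟨W, rfl⟩ : Z ∈ Set.range (scaledCast p N n) := by
        rw [range_scaledCast]
        exact fun i j => (hZ i j).trans
          (one_le_pow₀ (Nat.one_le_cast.2 (Fact.out : p.Prime).one_le))
      exact ⟨W, (hmem W).2 hZ, rfl⟩
  have h := addHaar_image volume (vol p N) _ (isOpenEmbedding_scaledCast N n) S
  rw [himg, vol_integerMatrices, hvS] at h
  rw [ENNReal.eq_inv_of_mul_eq_one_left h.symm, inv_inv]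

theorem vol_eq_volume_preimage (N n : ℕ) (E : Set (Matrix (Fin N) (Fin N) ℚ_[p]))
    (hE : ∀ Z ∈ E, ∀ i j, ‖Z i j‖ ≤ (p : ℝ) ^ n) :
    vol p N E = (p : ENNReal) ^ (n * (N * N)) * volume (scaledCast p N n ⁻¹' E) := by
  rw [← vol_range_scaledCast, ← addHaar_image volume (vol p N) _ (isOpenEmbedding_scaledCast N n),
    Set.image_preimage_eq_of_subset]
  rw [range_scaledCast]
  exact hE

theorem resCount_scaledCast (N n : ℕ) (W : Fin N → Fin N → ℤ_[p]) (ρ : ℝ) :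
    resCount (scaledCast p N n W) ρ = resCount (castMat (Matrix.of W)) (ρ / (p : ℝ) ^ n) := by
  rw [scaledCast_apply, resCount_smul _ (inv_ne_zero (pow_ne_zero n natCast_p_ne_zero))]
  simp

/-- Right multiplication by an invertible integral matrix preserves the volume of rows. -/
theorem measurePreserving_vecMul {c : ℕ} (C : (Matrix (Fin c) (Fin c) ℤ_[p])ˣ) :
    MeasurePreserving (fun r : Fin c → ℤ_[p] => Matrix.vecMul r (C : Matrix (Fin c) (Fin c) ℤ_[p]))
      volume volume := by
  let f : (Fin c → ℤ_[p]) →+ (Fin c → ℤ_[p]) :=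
    { toFun := fun r => Matrix.vecMul r (C : Matrix (Fin c) (Fin c) ℤ_[p])
      map_zero' := Matrix.zero_vecMul _
      map_add' := fun r r' => Matrix.add_vecMul _ r r' }
  have hf : Continuous f := continuous_pi fun j => by
    change Continuous fun r : Fin c → ℤ_[p] => ∑ i, r i * (C : Matrix (Fin c) (Fin c) ℤ_[p]) i j
    fun_prop
  have hs : Function.Surjective f := fun r =>
    ⟨Matrix.vecMul r ((C⁻¹ : (Matrix (Fin c) (Fin c) ℤ_[p])ˣ) : Matrix (Fin c) (Fin c) ℤ_[p]), by
      change Matrix.vecMul (Matrix.vecMul r _) (C : Matrix (Fin c) (Fin c) ℤ_[p]) = r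
      rw [Matrix.vecMul_vecMul, Units.inv_mul, Matrix.vecMul_one]⟩
  -- A continuous surjective endomorphism pushes the Haar probability measure to a Haar probability
  -- measure, which is unique.
  have h₁ := Measure.isAddHaarMeasure_map_of_isFiniteMeasure volume f hf hs
  have h₂ := Measure.isProbabilityMeasure_map (μ := volume) hf.aemeasurable
  exact ⟨hf.measurable, @Measure.isAddHaarMeasure_eq_of_isProbabilityMeasure _ _ _ _ _ _ _
    (Measure.map f volume) volume _ h₂ _ h₁⟩

theorem measurePreserving_removeNth {c : ℕ} (j : Fin (c + 1)) :
    MeasurePreserving (fun (r : Fin (c + 1) → ℤ_[p]) l => r (j.succAbove l)) volume volume :=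
  measurePreserving_snd.comp (volume_preserving_piFinSuccAbove (fun _ => ℤ_[p]) j)

/-- A row with a unit entry is the image of a coordinate form under an integral matrix. -/
theorem exists_vecMul_eq_single {c : ℕ} (r : Fin c → ℤ_[p]) (j : Fin c) (hj : IsUnit (r j)) :
    ∃ C : (Matrix (Fin c) (Fin c) ℤ_[p])ˣ,
      Matrix.vecMul r (C : Matrix (Fin c) (Fin c) ℤ_[p]) = Pi.single j 1 := by
  -- The identity with row `j` replaced by `r` sends `e_j` to `r`; its determinant is a unit, and
  -- its inverse is the required `C`.
  have hdet : (Matrix.updateRow (1 : Matrix (Fin c) (Fin c) ℤ_[p]) j r).det = r j := by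
    have := Matrix.cramer_transpose_apply (1 : Matrix (Fin c) (Fin c) ℤ_[p]) r j
    rw [Matrix.transpose_one, Matrix.cramer_one] at this
    exact this.symm
  have hu : IsUnit (Matrix.updateRow (1 : Matrix (Fin c) (Fin c) ℤ_[p]) j r) := by
    rwa [Matrix.isUnit_iff_isUnit_det, hdet]
  obtain ⟨M, hM⟩ := hu
  refine ⟨M⁻¹, ?_⟩
  have hr : r = Matrix.vecMul (Pi.single j 1) (M : Matrix (Fin c) (Fin c) ℤ_[p]) := by
    rw [hM, Matrix.single_one_vecMul]
    exact Matrix.updateRow_self.symm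
  conv_lhs => rw [hr]
  rw [Matrix.vecMul_vecMul, Units.mul_inv, Matrix.vecMul_one]

end Haar

/-! ## The law of the corank chain of a uniform integral matrix -/

section RowWeight

theorem pochOne_zero (p : ℕ) : pochOne p 0 = 1 := by simp [pochOne, qPoch]

theorem pochOne_succ (p n : ℕ) : pochOne p (n + 1) = pochOne p n * (1 - (p : ℝ)⁻¹ ^ (n + 1)) := by
  rw [pochOne, pochOne, qPoch, qPoch, Finset.prod_range_succ, pow_succ']

theorem pochS_zero_right (p n : ℕ) : pochS p 0 n = pochOne p n := by
  rw [pochS, pochOne, sub_zero, Real.rpow_neg_one]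

variable {p : ℕ} [Fact p.Prime]

theorem inv_p_pos : 0 < (p : ℝ)⁻¹ := inv_pos.2 (Nat.cast_pos.2 (Fact.out : p.Prime).pos)

theorem inv_p_lt_one : (p : ℝ)⁻¹ < 1 :=
  inv_lt_one_of_one_lt₀ (Nat.one_lt_cast.2 (Fact.out : p.Prime).one_lt)

theorem one_sub_inv_p_pow_pos (n : ℕ) : 0 < 1 - (p : ℝ)⁻¹ ^ (n + 1) :=
  sub_pos.2 (pow_lt_one₀ inv_p_pos.le inv_p_lt_one n.succ_ne_zero)

theorem pochOne_pos (n : ℕ) : 0 < pochOne p n := by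
  induction n with
  | zero => rw [pochOne_zero]; exact one_pos
  | succ n ih => rw [pochOne_succ]; exact mul_pos ih (one_sub_inv_p_pow_pos n)

/-- The probability that a uniform `u × (u + t)` matrix over `𝔽_p` has a left kernel of dimension
`y - t`. -/
def rowWeight (p u t y : ℕ) : ℝ :=
  if t ≤ y ∧ y ≤ u + t then
    (p : ℝ)⁻¹ ^ (y * (y - t)) * (pochOne p (u + t) * pochOne p u) /
      (pochOne p y * pochOne p (y - t) * pochOne p (u + t - y))
  else 0

theorem rowWeight_nonneg (u t y : ℕ) : 0 ≤ rowWeight p u t y := by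
  unfold rowWeight
  split_ifs
  · have h := fun n => (pochOne_pos (p := p) n).le
    exact div_nonneg (mul_nonneg (pow_nonneg inv_p_pos.le _) (mul_nonneg (h _) (h _)))
      (mul_nonneg (mul_nonneg (h _) (h _)) (h _))
  · exact le_rfl

theorem rowWeight_zero (t y : ℕ) : rowWeight p 0 t y = if y = t then 1 else 0 := by
  unfold rowWeight
  split_ifs with h1 h2 h2
  · subst h2
    simp [pochOne_zero, (pochOne_pos (p := p) y).ne']
  · omega
  · omega
  · rfl

/-- Probabilistically, one row over `𝔽_p` is revealed. If nonzero, it is removed with one column,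
which preserves the left kernel; if zero, it adds one dimension to the left kernel. The proof checks
the closed forms, with separate boundary cases where a term vanishes. -/
theorem rowWeight_succ (u t y : ℕ) :
    rowWeight p (u + 1) t y = (1 - (p : ℝ)⁻¹ ^ (u + t + 1)) * rowWeight p u t y +
      (p : ℝ)⁻¹ ^ (u + t + 1) * rowWeight p u (t + 1) y := by
  have hφ : ∀ n, pochOne p n ≠ 0 := fun n => (pochOne_pos n).ne'
  have hq : ∀ n, 1 - (p : ℝ)⁻¹ ^ (n + 1) ≠ 0 := fun n => (one_sub_inv_p_pow_pos n).ne'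
  rcases lt_trichotomy y t with h | rfl | h
  · rw [rowWeight, rowWeight, rowWeight, if_neg (by omega), if_neg (by omega), if_neg (by omega)]
    ring
  · rw [rowWeight, rowWeight, rowWeight, if_pos (by omega), if_pos (by omega), if_neg (by omega),
      show u + 1 + y = u + y + 1 by ring, show u + y + 1 - y = u + 1 by omega,
      Nat.add_sub_cancel, Nat.sub_self, pochOne_succ p (u + y), pochOne_zero]
    have := hφ y
    have := hφ u
    have := hφ (u + 1)
    field_simp
    ring
  obtain ⟨b, rfl⟩ : ∃ b, y = t + b + 1 := ⟨y - t - 1, by omega⟩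
  rcases lt_trichotomy u b with hub | rfl | hub
  · rw [rowWeight, rowWeight, rowWeight, if_neg (by omega), if_neg (by omega), if_neg (by omega)]
    ring
  · rw [rowWeight, rowWeight, rowWeight, if_pos (by omega), if_neg (by omega), if_pos (by omega),
      show u + 1 + t = t + u + 1 by ring, show u + (t + 1) = t + u + 1 by ring,
      show t + u + 1 - (t + 1) = u by omega, show t + u + 1 - t = u + 1 by omega, Nat.sub_self,
      pochOne_zero]
    have := hφ (t + u + 1)
    have := hφ u
    have := hφ (u + 1)
    rw [show (t + u + 1) * (u + 1) = (t + u + 1) * u + (t + u + 1) by ring, pow_add,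
      show u + t + 1 = t + u + 1 by ring]
    field_simp
    ring
  · obtain ⟨d, rfl⟩ : ∃ d, u = b + d + 1 := ⟨u - b - 1, by omega⟩
    rw [rowWeight, rowWeight, rowWeight, if_pos (by omega), if_pos (by omega), if_pos (by omega),
      show t + b + 1 - t = b + 1 by omega, show t + b + 1 - (t + 1) = b by omega,
      show b + d + 1 + 1 + t - (t + b + 1) = d + 1 by omega,
      show b + d + 1 + t - (t + b + 1) = d by omega,
      show b + d + 1 + (t + 1) - (t + b + 1) = d + 1 by omega,
      show b + d + 1 + 1 + t = b + d + 1 + t + 1 by ring,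
      show b + d + 1 + (t + 1) = b + d + 1 + t + 1 by ring,
      show (t + b + 1) * (b + 1) = (t + b + 1) * b + (t + b + 1) by ring, pow_add _ (_ * _),
      pochOne_succ p (b + d + 1 + t), pochOne_succ p (b + d + 1), pochOne_succ p b,
      pochOne_succ p d]
    have h1 := hφ (t + b + 1)
    have h2 := hφ b
    have h3 := hφ d
    have h4 := hq b
    have h5 := hq d
    have e1 : (p : ℝ)⁻¹ ^ (b + d + 1 + 1) = (p : ℝ)⁻¹ ^ (b + 1) * (p : ℝ)⁻¹ ^ (d + 1) := by
      rw [← pow_add]; congr 1; ring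
    have e2 : (p : ℝ)⁻¹ ^ (b + d + 1 + t + 1) = (p : ℝ)⁻¹ ^ (t + b + 1) * (p : ℝ)⁻¹ ^ (d + 1) := by
      rw [← pow_add]; congr 1; ring
    have e3 : (p : ℝ)⁻¹ ^ (t + b + 1) = (p : ℝ)⁻¹ ^ t * (p : ℝ)⁻¹ ^ (b + 1) := by
      rw [← pow_add]; congr 1
    rw [e1, e2, e3]
    -- All remaining powers of `p⁻¹` are monomials in these three, so what is left is a rational
    -- identity.
    generalize (p : ℝ)⁻¹ ^ (b + 1) = B at *
    generalize (p : ℝ)⁻¹ ^ (d + 1) = D at *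
    generalize (p : ℝ)⁻¹ ^ t = T at *
    field_simp
    ring

theorem rowWeight_eq_kernelP (N y : ℕ) : rowWeight p N 0 y = kernelP p 0 N y := by
  have hp : (0 : ℝ) < p := Nat.cast_pos.2 (Fact.out : p.Prime).pos
  unfold rowWeight kernelP
  simp only [Nat.zero_le, true_and, add_zero, Nat.sub_zero, zero_mul, sub_zero, pochS_zero_right]
  split_ifs with h
  · rw [Real.rpow_neg hp.le, inv_pow, show ((y : ℝ) ^ 2) = ((y * y : ℕ) : ℝ) by push_cast; ring,
      Real.rpow_natCast]
    ring
  · rfl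

end RowWeight

/-! ### Exposing the rows of a uniform integral matrix -/

section CorankChain

variable {p : ℕ} [Fact p.Prime]

/-- The matrix over `ℚ_p` whose `i`-th row is `p ^ e i` times the `i`-th row of `W`. -/
def scaleRows {a b : ℕ} (e : Fin a → ℕ) (W : Fin a → Fin b → ℤ_[p]) :
    Matrix (Fin a) (Fin b) ℚ_[p] :=
  Matrix.of fun i j => (p : ℚ_[p]) ^ e i * (W i j : ℚ_[p])

theorem continuous_scaleRows {a b : ℕ} (e : Fin a → ℕ) :
    Continuous (scaleRows (p := p) (b := b) e) :=
  continuous_pi fun i => continuous_pi fun j => by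
    have h : Continuous fun W : Fin a → Fin b → ℤ_[p] => W i j := by fun_prop
    exact continuous_const.mul (PadicInt.isOpenEmbedding_coe.continuous.comp h)

theorem zpow_neg_pos (i : ℕ) : 0 < (p : ℝ) ^ (-(i : ℤ)) :=
  zpow_pos (Nat.cast_pos.2 (Fact.out : p.Prime).pos) _

theorem zpow_neg_le_one (i : ℕ) : (p : ℝ) ^ (-(i : ℤ)) ≤ 1 := by
  rw [zpow_neg, zpow_natCast]
  exact inv_le_one_of_one_le₀ (one_le_pow₀ (Nat.one_le_cast.2 (Fact.out : p.Prime).one_le))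

/-- The square integral matrices `W` for which the row-scaled matrix has exactly `y i` singular
numbers below `-i`, for all `i ≤ m`. -/
def chainSet (p : ℕ) [Fact p.Prime] {a : ℕ} (e : Fin a → ℕ) (m : ℕ) (y : ℕ → ℕ) :
    Set (Fin a → Fin a → ℤ_[p]) :=
  {W | ∀ i ≤ m, resCount (scaleRows e W) ((p : ℝ) ^ (-(i : ℤ))) = p ^ y i}

theorem measurableSet_chainSet {a : ℕ} (e : Fin a → ℕ) (m : ℕ) (y : ℕ → ℕ) :
    MeasurableSet (chainSet p e m y) := by
  have : chainSet p e m y = ⋂ i, ⋂ (_ : i ≤ m),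
      {W | resCount (scaleRows e W) ((p : ℝ) ^ (-(i : ℤ))) = p ^ y i} := by
    ext
    simp [chainSet]
  rw [this]
  exact MeasurableSet.iInter fun i => MeasurableSet.iInter fun _ =>
    (isClosed_eq ((continuous_resCount (zpow_neg_pos i)).comp (continuous_scaleRows e))
      continuous_const).measurableSet

theorem volume_eq_lintegral_insertNth {a c : ℕ} (i : Fin (a + 1))
    {E : Set (Fin (a + 1) → Fin c → ℤ_[p])} (hE : MeasurableSet E) :
    volume E = ∫⁻ r : Fin c → ℤ_[p],
      volume {W : Fin a → Fin c → ℤ_[p] | (i.insertNth r W : Fin (a + 1) → Fin c → ℤ_[p]) ∈ E} := by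
  have h := (volume_preserving_piFinSuccAbove (fun _ : Fin (a + 1) => Fin c → ℤ_[p]) i).symm
  rw [← h.measure_preimage hE.nullMeasurableSet]
  exact Measure.prod_apply (h.measurable hE)

/-- Conditioned on being divisible by `p`, a uniform row is `p` times a uniform row. -/
theorem restrict_range_mulP (c : ℕ) :
    (volume : Measure (Fin c → ℤ_[p])).restrict (Set.range (mulP p c)) =
      ((p : ENNReal) ^ c)⁻¹ • volume.map (mulP p c) := by
  have hφ := (isOpenEmbedding_mulP (p := p) c).measurableEmbedding
  ext S hS
  rw [Measure.restrict_apply hS, ← Set.image_preimage_eq_inter_range, volume_image_mulP,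
    Measure.smul_apply, hφ.map_apply, smul_eq_mul]

theorem scaleRows_mul {a c : ℕ} (e : Fin a → ℕ) (W : Fin a → Fin c → ℤ_[p])
    (C : Matrix (Fin c) (Fin c) ℤ_[p]) :
    scaleRows e W * castMat C = scaleRows e fun k => Matrix.vecMul (W k) C := by
  ext i j
  simp only [scaleRows, Matrix.mul_apply, Matrix.of_apply, Matrix.vecMul, dotProduct,
    PadicInt.coe_sum, PadicInt.coe_mul, castMat_apply, Finset.mul_sum, mul_assoc]

/-- Right multiplication by `C` keeps every residue count and turns row `i` into `e_j`, after which
`resCount_insertNth_single` deletes it together with column `j`. -/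
theorem insertNth_mem_chainSet_iff {a : ℕ} (e : Fin (a + 1) → ℕ) (m : ℕ) (y : ℕ → ℕ)
    (i j : Fin (a + 1)) (hi : e i = 0) (r : Fin (a + 1) → ℤ_[p])
    (C : (Matrix (Fin (a + 1)) (Fin (a + 1)) ℤ_[p])ˣ)
    (hC : Matrix.vecMul r (C : Matrix (Fin (a + 1)) (Fin (a + 1)) ℤ_[p]) = Pi.single j 1)
    (W : Fin a → Fin (a + 1) → ℤ_[p]) :
    (i.insertNth r W : Fin (a + 1) → Fin (a + 1) → ℤ_[p]) ∈ chainSet p e m y ↔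
      (fun k l => Matrix.vecMul (W k) (C : Matrix (Fin (a + 1)) (Fin (a + 1)) ℤ_[p])
        (j.succAbove l)) ∈ chainSet p (fun k => e (i.succAbove k)) m y := by
  refine forall_congr' fun n => imp_congr_right fun _ => ?_
  rw [← resCount_right_mul _ C, scaleRows_mul]
  have : scaleRows e (fun k => Matrix.vecMul ((i.insertNth r W : Fin (a + 1) → Fin (a + 1) → ℤ_[p]) k)
        (C : Matrix (Fin (a + 1)) (Fin (a + 1)) ℤ_[p])) =
      Matrix.of (i.insertNth (Pi.single j 1 : Fin (a + 1) → ℚ_[p]) (fun k l =>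
        (p : ℚ_[p]) ^ e (i.succAbove k) * ((Matrix.vecMul (W k)
          (C : Matrix (Fin (a + 1)) (Fin (a + 1)) ℤ_[p]) l : ℤ_[p]) : ℚ_[p]))) := by
    ext k l
    cases k using Fin.succAboveCases i with
    | x =>
      by_cases hl : l = j <;>
        simp [scaleRows, hi, hC, hl]
    | p k => simp [scaleRows]
  rw [this, resCount_insertNth_single i j _ _ (zpow_neg_pos n) (zpow_neg_le_one n)]
  · rfl
  · intro k l
    rw [norm_mul, norm_pow, Padic.norm_p]
    exact mul_le_one₀ (pow_le_one₀ inv_p_pos.le inv_p_lt_one.le) (norm_nonneg _)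
      (PadicInt.norm_le_one _)

/-- The matrix `C` depends on `r`, but multiplying by it and dropping a coordinate preserve volume,
so the answer is the same for every unimodular `r`. -/
theorem volume_insertNth_of_isUnit {a : ℕ} (e : Fin (a + 1) → ℕ) (m : ℕ) (y : ℕ → ℕ)
    (i j : Fin (a + 1)) (hi : e i = 0) (r : Fin (a + 1) → ℤ_[p]) (hj : IsUnit (r j)) :
    volume {W : Fin a → Fin (a + 1) → ℤ_[p] |
        (i.insertNth r W : Fin (a + 1) → Fin (a + 1) → ℤ_[p]) ∈ chainSet p e m y} =
      volume (chainSet p (fun k => e (i.succAbove k)) m y) := by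
  obtain ⟨C, hC⟩ := exists_vecMul_eq_single r j hj
  simp only [insertNth_mem_chainSet_iff e m y i j hi r C hC]
  have hT : MeasurePreserving (fun (W : Fin a → Fin (a + 1) → ℤ_[p]) k l =>
      Matrix.vecMul (W k) (C : Matrix (Fin (a + 1)) (Fin (a + 1)) ℤ_[p]) (j.succAbove l))
      volume volume :=
    volume_preserving_pi fun _ => (measurePreserving_removeNth j).comp (measurePreserving_vecMul C)
  exact hT.measure_preimage (measurableSet_chainSet _ m y).nullMeasurableSet

theorem insertNth_mulP_mem_chainSet_iff {a : ℕ} (e : Fin (a + 1) → ℕ) (m : ℕ) (y : ℕ → ℕ)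
    (i : Fin (a + 1)) (hi : e i = 0) (r : Fin (a + 1) → ℤ_[p]) (W : Fin a → Fin (a + 1) → ℤ_[p]) :
    (i.insertNth (mulP p (a + 1) r) W : Fin (a + 1) → Fin (a + 1) → ℤ_[p]) ∈ chainSet p e m y ↔
      (i.insertNth r W : Fin (a + 1) → Fin (a + 1) → ℤ_[p]) ∈
        chainSet p (Function.update e i 1) m y := by
  have : scaleRows e (i.insertNth (mulP p (a + 1) r) W : Fin (a + 1) → Fin (a + 1) → ℤ_[p]) =
      scaleRows (Function.update e i 1) (i.insertNth r W : Fin (a + 1) → Fin (a + 1) → ℤ_[p]) := by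
    ext k l
    cases k using Fin.succAboveCases i with
    | x => simp [scaleRows, hi, mulP]
    | p k => simp [scaleRows]
  simp only [chainSet, Set.mem_ofPred_eq, this]

/-- Exposing one unscaled row: either it is divisible by `p`, or it is unimodular and can be
removed together with one column. -/
theorem volume_chainSet_step {a : ℕ} (e : Fin (a + 1) → ℕ) (m : ℕ) (y : ℕ → ℕ) (i : Fin (a + 1))
    (hi : e i = 0) :
    volume (chainSet p e m y) =
      (1 - ((p : ENNReal) ^ (a + 1))⁻¹) * volume (chainSet p (fun k => e (i.succAbove k)) m y) +
        ((p : ENNReal) ^ (a + 1))⁻¹ * volume (chainSet p (Function.update e i 1) m y) := by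
  have hE := measurableSet_chainSet (p := p) e m y
  have hR : MeasurableSet (Set.range (mulP p (a + 1))) :=
    (isOpenEmbedding_mulP (p := p) (a + 1)).isOpen_range.measurableSet
  rw [volume_eq_lintegral_insertNth i hE, ← lintegral_add_compl _ hR, add_comm]
  congr 1
  · have hconst : Set.EqOn (fun r : Fin (a + 1) → ℤ_[p] =>
        volume {W : Fin a → Fin (a + 1) → ℤ_[p] |
          (i.insertNth r W : Fin (a + 1) → Fin (a + 1) → ℤ_[p]) ∈ chainSet p e m y})
        (fun _ => volume (chainSet p (fun k => e (i.succAbove k)) m y))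
        (Set.range (mulP p (a + 1)))ᶜ := by
      intro r hr
      rw [range_mulP] at hr
      simp only [Set.mem_compl_iff, Set.mem_pi, Set.mem_univ, true_implies, Set.mem_ofPred_eq,
        not_forall, not_lt] at hr
      obtain ⟨j, hj⟩ := hr
      exact volume_insertNth_of_isUnit e m y i j hi r
        (PadicInt.isUnit_iff.2 (le_antisymm (PadicInt.norm_le_one _) hj))
    rw [setLIntegral_congr_fun hR.compl hconst, setLIntegral_const, prob_compl_eq_one_sub hR,
      volume_range_mulP, mul_comm]
  · rw [restrict_range_mulP, lintegral_smul_measure, smul_eq_mul,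
      (isOpenEmbedding_mulP (p := p) (a + 1)).measurableEmbedding.lintegral_map,
      volume_eq_lintegral_insertNth i (measurableSet_chainSet (Function.update e i 1) m y)]
    simp only [insertNth_mulP_mem_chainSet_iff e m y i hi]

/-- The probability of the conditions on `y 1, …, y m` given `y 0`. -/
def tailVolume (p : ℕ) [Fact p.Prime] (y : ℕ → ℕ) : ℕ → ENNReal
  | 0 => 1
  | m + 1 => volume (chainSet p (0 : Fin (y 0) → ℕ) m fun i => y (i + 1))

/-- The renewal step. With all rows scaled the matrix is `p W` with `W` uniform: its level-`0` count
is forced to be `a`, and its level `i + 1` is level `i` of `W`. -/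
theorem volume_chainSet_one (a m : ℕ) (y : ℕ → ℕ) :
    volume (chainSet p (1 : Fin a → ℕ) m y) = if y 0 = a then tailVolume p y m else 0 := by
  have hsmul : ∀ W : Fin a → Fin a → ℤ_[p],
      scaleRows 1 W = (p : ℚ_[p]) • scaleRows 0 W := by
    intro W
    ext i j
    simp [scaleRows]
  have hp1 : (1 : ℝ) < p := Nat.one_lt_cast.2 (Fact.out : p.Prime).one_lt
  have h0 : ∀ W : Fin a → Fin a → ℤ_[p],
      resCount (scaleRows 1 W) ((p : ℝ) ^ (-((0 : ℕ) : ℤ))) = p ^ a := by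
    intro W
    rw [resCount_eq_pow_card (zpow_neg_pos 0), Fintype.card_fin]
    intro i j
    simp only [scaleRows, Matrix.of_apply, Pi.one_apply, pow_one, norm_mul, Padic.norm_p,
      Nat.cast_zero, neg_zero, zpow_zero]
    exact (mul_le_of_le_one_right inv_p_pos.le (PadicInt.norm_le_one _)).trans_lt inv_p_lt_one
  split_ifs with h
  · subst h
    cases m with
    | zero =>
      have : chainSet p (1 : Fin (y 0) → ℕ) 0 y = Set.univ := by
        refine Set.eq_univ_of_forall fun W i hi => ?_
        obtain rfl := Nat.le_zero.1 hi
        exact h0 W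
      rw [this, measure_univ]
      rfl
    | succ m =>
      have : chainSet p (1 : Fin (y 0) → ℕ) (m + 1) y =
          chainSet p (0 : Fin (y 0) → ℕ) m fun i => y (i + 1) := by
        have hres : ∀ (W : Fin (y 0) → Fin (y 0) → ℤ_[p]) (i : ℕ),
            resCount (scaleRows 1 W) ((p : ℝ) ^ (-((i + 1 : ℕ) : ℤ))) =
              resCount (scaleRows 0 W) ((p : ℝ) ^ (-(i : ℤ))) := by
          intro W i
          rw [hsmul, resCount_smul _ natCast_p_ne_zero, Padic.norm_p, div_inv_eq_mul]
          congr 1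
          rw [← zpow_add_one₀ (zero_lt_one.trans hp1).ne']
          congr 1
          push_cast
          ring
        ext W
        constructor
        · intro hW i hi
          rw [← hres]
          exact hW (i + 1) (by omega)
        · intro hW i hi
          cases i with
          | zero => exact h0 W
          | succ i =>
            rw [hres]
            exact hW i (by omega)
      rw [this]
      rfl
  · have : chainSet p (1 : Fin a → ℕ) m y = ∅ := by
      refine Set.eq_empty_of_forall_notMem fun W hW => h ?_
      have := hW 0 (Nat.zero_le m)
      rw [h0] at this
      exact (Nat.pow_right_injective (Fact.out : p.Prime).two_le this).symm
    rw [this, measure_empty]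

/-- Induction on the number `u` of unscaled rows, with `t` scaled ones: exposing a row leads to `(u
- 1, t)` or `(u - 1, t + 1)`, matching `rowWeight_succ`, until `volume_chainSet_one` applies. -/
theorem volume_chainSet (u : ℕ) : ∀ {a : ℕ} (t : ℕ) (_ : a = u + t) (e : Fin a → ℕ)
    (_ : ∀ i, e i ≤ 1) (_ : ∑ i, e i = t) (m : ℕ) (y : ℕ → ℕ),
    volume (chainSet p e m y) = ENNReal.ofReal (rowWeight p u t (y 0)) * tailVolume p y m := by
  induction u with
  | zero =>
    intro a t ha e he ht m y
    have he1 : e = 1 := by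
      have h : ∑ i, e i = ∑ _i : Fin a, 1 := by simp; omega
      exact funext fun i => (Finset.sum_eq_sum_iff_of_le fun i _ => he i).1 h i (Finset.mem_univ i)
    rw [he1, volume_chainSet_one, rowWeight_zero, show t = a by omega]
    split_ifs <;> simp
  | succ u ih =>
    intro a t ha e he ht m y
    obtain ⟨a, rfl⟩ : ∃ b, a = b + 1 := ⟨u + t, by omega⟩
    obtain ⟨i, hi⟩ : ∃ i, e i = 0 := by
      by_contra hne
      push Not at hne
      have h : ∑ i, e i = ∑ _i : Fin (a + 1), 1 :=
        Finset.sum_congr rfl fun i _ => le_antisymm (he i) (Nat.one_le_iff_ne_zero.2 (hne i))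
      simp at h
      omega
    rw [volume_chainSet_step e m y i hi, ih (a := a) t (by omega) _ (fun k => he _) ?_ m y,
      ih (a := a + 1) (t + 1) (by omega) (Function.update e i 1) ?_ ?_ m y, rowWeight_succ]
    · have hq : ((p : ENNReal) ^ (a + 1))⁻¹ = ENNReal.ofReal ((p : ℝ)⁻¹ ^ (u + t + 1)) := by
        rw [ENNReal.ofReal_pow inv_p_pos.le, ENNReal.ofReal_inv_of_pos
          (Nat.cast_pos.2 (Fact.out : p.Prime).pos), ENNReal.ofReal_natCast, ENNReal.inv_pow]
        congr 1
        omega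
      have hq0 : 0 ≤ (p : ℝ)⁻¹ ^ (u + t + 1) := pow_nonneg inv_p_pos.le _
      rw [hq, ENNReal.ofReal_add, ENNReal.ofReal_mul, ENNReal.ofReal_mul hq0, ENNReal.ofReal_sub _ hq0,
        ENNReal.ofReal_one]
      · ring
      · exact (one_sub_inv_p_pow_pos _).le
      · exact mul_nonneg (one_sub_inv_p_pow_pos _).le (rowWeight_nonneg _ _ _)
      · exact mul_nonneg hq0 (rowWeight_nonneg _ _ _)
    · intro k
      by_cases hk : k = i <;> simp [hk, he]
    · rw [Fin.sum_univ_succAbove _ i] at ht ⊢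
      simp [← ht, hi, add_comm]
    · rw [Fin.sum_univ_succAbove _ i, hi, zero_add] at ht
      exact ht

theorem kernelP_zero_nonneg (x y : ℕ) : 0 ≤ kernelP p 0 x y := by
  rw [← rowWeight_eq_kernelP]
  exact rowWeight_nonneg _ _ _

theorem volume_chainSet_zero (m : ℕ) : ∀ (N : ℕ) (y : ℕ → ℕ),
    volume (chainSet p (0 : Fin N → ℕ) m y) =
      ENNReal.ofReal (kernelP p 0 N (y 0) *
        ∏ i ∈ Finset.range m, kernelP p 0 (y i) (y (i + 1))) := by
  induction m with
  | zero =>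
    intro N y
    rw [volume_chainSet N 0 rfl (0 : Fin N → ℕ) (fun _ => Nat.zero_le _) (by simp), rowWeight_eq_kernelP]
    simp [tailVolume]
  | succ m ih =>
    intro N y
    rw [volume_chainSet N 0 rfl (0 : Fin N → ℕ) (fun _ => Nat.zero_le _) (by simp), rowWeight_eq_kernelP,
      tailVolume, ih, Finset.prod_range_succ', mul_comm (∏ i ∈ _, _),
      ENNReal.ofReal_mul (kernelP_zero_nonneg N (y 0))]

end CorankChain

/-! ## `q`-binomial identities -/

section QIdentities

theorem qPoch_zero (a q : ℝ) : qPoch a q 0 = 1 := rfl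

theorem qPoch_succ (a q : ℝ) (n : ℕ) : qPoch a q (n + 1) = qPoch a q n * (1 - a * q ^ n) :=
  Finset.prod_range_succ _ _

theorem qPoch_succ' (a q : ℝ) (n : ℕ) : qPoch a q (n + 1) = (1 - a) * qPoch (a * q) q n := by
  rw [qPoch, qPoch, Finset.prod_range_succ', mul_comm]
  simp only [pow_succ', mul_assoc, pow_zero, mul_one]

/-- The Gaussian binomial coefficient. -/
def gaussBinom (q : ℝ) : ℕ → ℕ → ℝ
  | _, 0 => 1
  | 0, _ + 1 => 0
  | n + 1, k + 1 => gaussBinom q n (k + 1) + q ^ (n - k) * gaussBinom q n k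

theorem gaussBinom_zero_right (q : ℝ) (n : ℕ) : gaussBinom q n 0 = 1 := by
  cases n <;> rfl

theorem gaussBinom_succ_succ (q : ℝ) (n k : ℕ) : gaussBinom q (n + 1) (k + 1) =
    gaussBinom q n (k + 1) + q ^ (n - k) * gaussBinom q n k := rfl

theorem gaussBinom_of_lt (q : ℝ) {n k : ℕ} (h : n < k) : gaussBinom q n k = 0 := by
  induction n generalizing k with
  | zero =>
    obtain ⟨k, rfl⟩ : ∃ l, k = l + 1 := ⟨k - 1, by omega⟩
    rfl
  | succ n ih =>
    obtain ⟨k, rfl⟩ : ∃ l, k = l + 1 := ⟨k - 1, by omega⟩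
    rw [gaussBinom_succ_succ, ih (by omega), ih (by omega), mul_zero, add_zero]

theorem gaussBinom_mul (q : ℝ) (k d : ℕ) :
    gaussBinom q (k + d) k * (qPoch q q k * qPoch q q d) = qPoch q q (k + d) := by
  induction h : k + d generalizing k d with
  | zero =>
    obtain ⟨rfl, rfl⟩ : k = 0 ∧ d = 0 := by omega
    simp [gaussBinom_zero_right, qPoch_zero]
  | succ n ih =>
    cases k with
    | zero =>
      obtain rfl : d = n + 1 := by omega
      simp [gaussBinom_zero_right, qPoch_zero]
    | succ k =>
      rw [gaussBinom_succ_succ, show n - k = d by omega]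
      have h2 := ih k d (by omega)
      cases d with
      | zero =>
        rw [gaussBinom_of_lt q (show n < k + 1 by omega), qPoch_succ q q n, ← h2, qPoch_succ]
        obtain rfl : n = k := by omega
        ring
      | succ d =>
        have h1 := ih (k + 1) d (by omega)
        rw [qPoch_succ q q n]
        calc _ = (gaussBinom q n (k + 1) * (qPoch q q (k + 1) * qPoch q q d)) * (1 - q * q ^ d) +
              q ^ (d + 1) * (gaussBinom q n k * (qPoch q q k * qPoch q q (d + 1))) *
                (1 - q * q ^ k) := by rw [qPoch_succ q q d, qPoch_succ q q k]; ring
          _ = _ := by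
            rw [h1, h2, show n = k + d + 1 by omega]
            ring

/-- Pascal's rule under a sum; it drives the inductions for both summation identities below. -/
theorem sum_gaussBinom_succ (q : ℝ) (n : ℕ) (g : ℕ → ℝ) :
    ∑ y ∈ Finset.range (n + 2), gaussBinom q (n + 1) y * g y =
      ∑ y ∈ Finset.range (n + 1), gaussBinom q n y * g y +
        ∑ y ∈ Finset.range (n + 1), gaussBinom q n y * (q ^ (n - y) * g (y + 1)) := by
  have h : ∑ y ∈ Finset.range (n + 1), gaussBinom q n y * g y =
      ∑ y ∈ Finset.range (n + 2), gaussBinom q n y * g y := by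
    rw [Finset.sum_range_succ _ (n + 1), gaussBinom_of_lt q (Nat.lt_succ_self n), zero_mul,
      add_zero]
  rw [h, Finset.sum_range_succ' _ (n + 1), Finset.sum_range_succ' _ (n + 1),
    gaussBinom_zero_right, gaussBinom_zero_right, add_right_comm, ← Finset.sum_add_distrib]
  congr 1
  refine Finset.sum_congr rfl fun y _ => ?_
  rw [gaussBinom_succ_succ]
  ring

/-- In Pascal's rule the shifted sum is a multiple of the same sum at `b q`, which is why `b` varies
in the induction. It remains that `1/(b;q)_n + b q^n/(b;q)_{n+1} = 1/(b;q)_{n+1}`. -/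
theorem sum_gaussBinom_durfee (q : ℝ) (n : ℕ) : ∀ b : ℝ, (∀ j : ℕ, 1 - b * q ^ j ≠ 0) →
    ∑ y ∈ Finset.range (n + 1), gaussBinom q n y * (q ^ (y * (y - 1)) * b ^ y / qPoch b q y) =
      (qPoch b q n)⁻¹ := by
  induction n with
  | zero => intro b _; simp [gaussBinom_zero_right, qPoch_zero]
  | succ n ih =>
    intro b hb
    have hb' : ∀ j : ℕ, 1 - b * q * q ^ j ≠ 0 := fun j => by
      rw [mul_assoc, ← pow_succ']
      exact hb (j + 1)
    have hne : ∀ b : ℝ, (∀ j : ℕ, 1 - b * q ^ j ≠ 0) → ∀ m, qPoch b q m ≠ 0 := fun b hb m =>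
      Finset.prod_ne_zero_iff.2 fun j _ => hb j
    have hb0 : 1 - b ≠ 0 := by simpa using hb 0
    have hshift : ∀ y ∈ Finset.range (n + 1), gaussBinom q n y * (q ^ (n - y) *
        (q ^ ((y + 1) * (y + 1 - 1)) * b ^ (y + 1) / qPoch b q (y + 1))) =
        b * q ^ n / (1 - b) * (gaussBinom q n y *
          (q ^ (y * (y - 1)) * (b * q) ^ y / qPoch (b * q) q y)) := by
      intro y hy
      have hy' : y ≤ n := Nat.lt_succ_iff.1 (Finset.mem_range.1 hy)
      have hpow : q ^ (n - y) * q ^ ((y + 1) * (y + 1 - 1)) = q ^ n * q ^ (y * (y - 1)) * q ^ y := by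
        rw [← pow_add, ← pow_add, ← pow_add]
        congr 1
        obtain ⟨d, rfl⟩ := Nat.exists_eq_add_of_le hy'
        rw [Nat.add_sub_cancel_left, Nat.add_sub_cancel]
        cases y with
        | zero => simp
        | succ y => rw [Nat.add_sub_cancel]; ring
      rw [qPoch_succ', mul_pow]
      have := hne _ hb' y
      field_simp
      linear_combination (gaussBinom q n y * b ^ (y + 1)) * hpow
    rw [sum_gaussBinom_succ, ih b hb, Finset.sum_congr rfl hshift, ← Finset.mul_sum, ih _ hb']
    have h1 := hne _ hb n
    have h2 := hne _ hb' n
    have h3 := hne _ hb (n + 1)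
    have e1 := qPoch_succ b q n
    have e2 := qPoch_succ' b q n
    have : b * q ^ n / (1 - b) * (qPoch (b * q) q n)⁻¹ = b * q ^ n * (qPoch b q (n + 1))⁻¹ := by
      rw [e2]
      field_simp
    rw [this, e1]
    have h4 := hb n
    field_simp
    ring

/-- The Gaussian binomial coefficient "`c` over `k`" with real parameter `c = q ^ x`. -/
def gaussBinomReal (q c : ℝ) (k : ℕ) : ℝ :=
  ∏ j ∈ Finset.range k, (1 - c * q⁻¹ ^ j) / (1 - q ^ (j + 1))

theorem gaussBinomReal_succ (q c : ℝ) (k : ℕ) : gaussBinomReal q c (k + 1) =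
    gaussBinomReal q c k * ((1 - c * q⁻¹ ^ k) / (1 - q ^ (k + 1))) :=
  Finset.prod_range_succ _ _

theorem gaussBinomReal_mul_succ (q c : ℝ) (hq : q ≠ 0) (hq1 : ∀ j : ℕ, 1 - q ^ (j + 1) ≠ 0) (k : ℕ) :
    gaussBinomReal q (c * q) (k + 1) = gaussBinomReal q c k * ((1 - c * q) / (1 - q ^ (k + 1))) := by
  induction k with
  | zero => simp [gaussBinomReal]
  | succ k ih =>
    rw [gaussBinomReal_succ, ih, gaussBinomReal_succ, pow_succ q⁻¹ k]
    have := hq1 k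
    have := hq1 (k + 1)
    field_simp

theorem gaussBinomReal_pascal (q c : ℝ) (hq : q ≠ 0) (hq1 : ∀ j : ℕ, 1 - q ^ (j + 1) ≠ 0) (k : ℕ) :
    gaussBinomReal q (c * q) (k + 1) =
      gaussBinomReal q c k + q ^ (k + 1) * gaussBinomReal q c (k + 1) := by
  rw [gaussBinomReal_mul_succ q c hq hq1, gaussBinomReal_succ, inv_pow]
  have := hq1 k
  field_simp
  ring

/-- The `q`-Vandermonde convolution. -/
theorem sum_gaussBinom_vandermonde (q c : ℝ) (hq : q ≠ 0) (hq1 : ∀ j : ℕ, 1 - q ^ (j + 1) ≠ 0)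
    (n : ℕ) : ∀ d : ℕ, ∑ y ∈ Finset.range (n + 1), gaussBinom q n y *
      (q ^ (y * (y + d)) * gaussBinomReal q c (y + d)) = gaussBinomReal q (c * q ^ n) (n + d) := by
  induction n with
  | zero => intro d; simp [gaussBinom_zero_right]
  | succ n ih =>
    intro d
    -- The shifted sum is the same convolution with `d + 1`, hence the quantifier over `d`.
    have hshift : ∀ y ∈ Finset.range (n + 1), gaussBinom q n y * (q ^ (n - y) *
        (q ^ ((y + 1) * (y + 1 + d)) * gaussBinomReal q c (y + 1 + d))) =
        q ^ (n + d + 1) * (gaussBinom q n y * (q ^ (y * (y + (d + 1))) *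
          gaussBinomReal q c (y + (d + 1)))) := by
      intro y hy
      have hy' : y ≤ n := Nat.lt_succ_iff.1 (Finset.mem_range.1 hy)
      have hpow : q ^ (n - y) * q ^ ((y + 1) * (y + 1 + d)) =
          q ^ (n + d + 1) * q ^ (y * (y + (d + 1))) := by
        rw [← pow_add, ← pow_add]
        congr 1
        obtain ⟨e, rfl⟩ := Nat.exists_eq_add_of_le hy'
        rw [Nat.add_sub_cancel_left]
        ring
      rw [show y + 1 + d = y + (d + 1) by ring] at hpow ⊢
      linear_combination (gaussBinom q n y * gaussBinomReal q c (y + (d + 1))) * hpow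
    rw [sum_gaussBinom_succ, ih, Finset.sum_congr rfl hshift, ← Finset.mul_sum, ih, pow_succ q n,
      ← mul_assoc c, show n + 1 + d = n + d + 1 by ring, gaussBinomReal_pascal _ _ hq hq1]
    rfl

/-- With this top parameter the numerators are exactly the last `k` factors of `(a; q)_{k+d}`. -/
theorem gaussBinomReal_mul_qPoch (q a : ℝ) (hq : q ≠ 0) (hq1 : ∀ j : ℕ, 1 - q ^ (j + 1) ≠ 0)
    (k d : ℕ) : gaussBinomReal q (a * q ^ (k + d) * q⁻¹) k * (qPoch q q k * qPoch a q d) =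
      qPoch a q (k + d) := by
  induction k generalizing d with
  | zero => simp [gaussBinomReal, qPoch_zero]
  | succ k ih =>
    have h := ih (d + 1)
    rw [qPoch_succ a q d, show k + (d + 1) = k + 1 + d by ring] at h
    rw [gaussBinomReal_succ, qPoch_succ q q k, ← h]
    have e : 1 - a * q ^ (k + 1 + d) * q⁻¹ * q⁻¹ ^ k = 1 - a * q ^ d := by
      rw [mul_assoc, ← pow_succ', inv_pow, show k + 1 + d = d + (k + 1) by ring, pow_add,
        mul_assoc a, mul_assoc, mul_inv_cancel₀ (pow_ne_zero _ hq), mul_one]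
    rw [e, ← pow_succ']
    have := hq1 k
    field_simp

end QIdentities

/-! ## The kernels and the initial distribution -/

section Kernels

theorem kernelP_of_lt {p : ℕ} {s : ℝ} {x y : ℕ} (h : x < y) : kernelP p s x y = 0 :=
  if_neg (not_le.2 h)

variable {p : ℕ} [Fact p.Prime] {s : ℝ}

theorem cast_p_pos : (0 : ℝ) < p := Nat.cast_pos.2 (Fact.out : p.Prime).pos

theorem one_sub_rpow_mul_pos (hs : -1 < s) (j : ℕ) :
    0 < 1 - (p : ℝ) ^ (-1 - s) * (p : ℝ)⁻¹ ^ j := by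
  have h1 : (p : ℝ) ^ (-1 - s) < 1 :=
    Real.rpow_lt_one_of_one_lt_of_neg (Nat.one_lt_cast.2 (Fact.out : p.Prime).one_lt) (by linarith)
  have h2 : (p : ℝ)⁻¹ ^ j ≤ 1 := pow_le_one₀ inv_p_pos.le inv_p_lt_one.le
  have h3 : 0 ≤ (p : ℝ) ^ (-1 - s) := Real.rpow_nonneg cast_p_pos.le _
  nlinarith

theorem pochS_pos (hs : -1 < s) (n : ℕ) : 0 < pochS p s n := by
  unfold pochS qPoch
  exact Finset.prod_pos fun j _ => one_sub_rpow_mul_pos hs j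

theorem kernelP_nonneg (hs : -1 < s) (x y : ℕ) : 0 ≤ kernelP p s x y := by
  unfold kernelP
  split_ifs
  · have h1 := fun n => (pochOne_pos (p := p) n).le
    have h2 := fun n => (pochS_pos (p := p) hs n).le
    exact div_nonneg (mul_nonneg (mul_nonneg (Real.rpow_nonneg cast_p_pos.le _) (h1 _)) (h2 _))
      (mul_nonneg (mul_nonneg (h1 _) (h1 _)) (h2 _))
  · exact le_rfl

theorem kernelP_pos (hs : -1 < s) {x y : ℕ} (h : y ≤ x) : 0 < kernelP p s x y := by
  rw [kernelP, if_pos h]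
  have h1 := fun n => (pochOne_pos (p := p) n)
  have h2 := fun n => (pochS_pos (p := p) hs n)
  exact div_pos (mul_pos (mul_pos (Real.rpow_pos_of_pos cast_p_pos _) (h1 _)) (h2 _))
    (mul_pos (mul_pos (h1 _) (h1 _)) (h2 _))

theorem rpow_neg_sq_sub (y : ℕ) : (p : ℝ) ^ (-(y : ℝ) ^ 2 - s * y) =
    (p : ℝ)⁻¹ ^ (y * (y - 1)) * ((p : ℝ) ^ (-1 - s)) ^ y := by
  have hy : ((y * (y - 1) : ℕ) : ℝ) = (y : ℝ) ^ 2 - y := by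
    cases y with
    | zero => simp
    | succ y =>
      rw [Nat.add_sub_cancel]
      push_cast
      ring
  rw [inv_pow, ← Real.rpow_natCast (p : ℝ), ← Real.rpow_natCast (_ ^ (-1 - s)), ← Real.rpow_mul cast_p_pos.le,
    ← Real.rpow_neg cast_p_pos.le, ← Real.rpow_add cast_p_pos, hy]
  congr 1
  ring

/-- This is `sum_gaussBinom_durfee` at `q = p⁻¹`, `b = p^{-1-s}`, multiplied by `(b; q)_x`. -/
theorem sum_kernelP (hs : -1 < s) (x : ℕ) : ∑ y ∈ Finset.range (x + 1), kernelP p s x y = 1 := by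
  have h := sum_gaussBinom_durfee (p : ℝ)⁻¹ x ((p : ℝ) ^ (-1 - s))
    fun j => (one_sub_rpow_mul_pos hs j).ne'
  have h1 := fun n => (pochOne_pos (p := p) n).ne'
  have h2 := fun n => (pochS_pos (p := p) hs n).ne'
  have hx : qPoch ((p : ℝ) ^ (-1 - s)) (p : ℝ)⁻¹ x = pochS p s x := rfl
  rw [← mul_inv_cancel₀ (h2 x), ← hx, ← h, Finset.mul_sum]
  refine Finset.sum_congr rfl fun y hy => ?_
  obtain ⟨d, rfl⟩ := Nat.exists_eq_add_of_le (Nat.lt_succ_iff.1 (Finset.mem_range.1 hy))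
  have hg := gaussBinom_mul (p : ℝ)⁻¹ y d
  have hy' : qPoch ((p : ℝ) ^ (-1 - s)) (p : ℝ)⁻¹ y = pochS p s y := rfl
  change _ * (pochOne p y * pochOne p d) = pochOne p (y + d) at hg
  rw [kernelP, if_pos (Nat.le_add_right _ _), rpow_neg_sq_sub, Nat.add_sub_cancel_left, hx, hy', ← hg]
  have := h1 y
  have := h1 d
  have := h2 y
  field_simp

theorem isTransitionKernel_kernelP (hs : -1 < s) : IsTransitionKernel (kernelP p s) := by
  refine ⟨kernelP_nonneg hs, fun x => ?_⟩
  rw [← sum_kernelP (p := p) hs x]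
  refine hasSum_sum_of_ne_finset_zero fun y hy => kernelP_of_lt ?_
  simpa using hy

theorem piTilde_nonneg (hs : -1 < s) (N x : ℕ) : 0 ≤ piTilde p N s x := by
  unfold piTilde
  split_ifs
  · have h1 := fun n => (pochOne_pos (p := p) n).le
    have h2 := fun n => (pochS_pos (p := p) hs n).le
    exact mul_nonneg (div_nonneg (mul_nonneg (sq_nonneg _) (sq_nonneg _)) (mul_nonneg
      (mul_nonneg (mul_nonneg (h2 _) (h1 _)) (h2 _)) (sq_nonneg _)))
      (Real.rpow_nonneg cast_p_pos.le _)
  · exact le_rfl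

theorem sum_piTilde (hs : -1 < s) (N : ℕ) :
    ∑ x ∈ Finset.range (N + 1), piTilde p N s x = 1 := by
  have hq : (p : ℝ)⁻¹ ≠ 0 := inv_p_pos.ne'
  have hq1 : ∀ j : ℕ, 1 - (p : ℝ)⁻¹ ^ (j + 1) ≠ 0 := fun j => (one_sub_inv_p_pow_pos j).ne'
  set a := (p : ℝ) ^ (-1 - s) with ha
  have h1 := fun n => (pochOne_pos (p := p) n).ne'
  have h2 := fun n => (pochS_pos (p := p) hs n).ne'
  -- With `q = p⁻¹` and `y = N - x`, the weights are multiples of Vandermonde summands at `c = a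
  -- q^{N-1}`. The sum has top parameter `a q^{2N-1}`, which `hr` evaluates.
  have hv := sum_gaussBinom_vandermonde (p : ℝ)⁻¹ (a * (p : ℝ)⁻¹ ^ N * (p : ℝ)⁻¹⁻¹) hq hq1 N 0
  have hr := gaussBinomReal_mul_qPoch (p : ℝ)⁻¹ a hq hq1 N N
  change _ * (pochOne p N * pochS p s N) = pochS p s (N + N) at hr
  rw [show a * (p : ℝ)⁻¹ ^ (N + N) * (p : ℝ)⁻¹⁻¹ =
    a * (p : ℝ)⁻¹ ^ N * (p : ℝ)⁻¹⁻¹ * (p : ℝ)⁻¹ ^ N by rw [pow_add]; ring] at hr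
  have hterm : ∀ y ∈ Finset.range (N + 1), piTilde p N s (N + 1 - 1 - y) =
      pochS p s N * pochOne p N / pochS p s (2 * N) * (gaussBinom (p : ℝ)⁻¹ N y *
        ((p : ℝ)⁻¹ ^ (y * (y + 0)) *
          gaussBinomReal (p : ℝ)⁻¹ (a * (p : ℝ)⁻¹ ^ N * (p : ℝ)⁻¹⁻¹) (y + 0))) := by
    intro y hy
    obtain ⟨d, rfl⟩ := Nat.exists_eq_add_of_le (Nat.lt_succ_iff.1 (Finset.mem_range.1 hy))
    have hg := gaussBinom_mul (p : ℝ)⁻¹ y d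
    have hg2 := gaussBinomReal_mul_qPoch (p : ℝ)⁻¹ a hq hq1 y d
    change _ * (pochOne p y * pochOne p d) = pochOne p (y + d) at hg
    change _ * (pochOne p y * pochS p s d) = pochS p s (y + d) at hg2
    have hpow : (p : ℝ) ^ (-(((y + d : ℕ) : ℝ) - (d : ℕ)) ^ 2) = (p : ℝ)⁻¹ ^ (y * y) := by
      rw [inv_pow, ← Real.rpow_natCast (p : ℝ), ← Real.rpow_neg cast_p_pos.le]
      congr 1
      push_cast
      ring
    rw [Nat.add_sub_cancel, Nat.add_sub_cancel_left, piTilde, if_pos (Nat.le_add_left _ _),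
      Nat.add_sub_cancel, hpow, add_zero]
    have e1 := h1 y
    have e2 := h1 d
    have e3 := h2 d
    have e4 := h2 (2 * (y + d))
    rw [← eq_div_iff (mul_ne_zero e1 e2)] at hg
    rw [← eq_div_iff (mul_ne_zero e1 e3)] at hg2
    rw [hg, hg2]
    field_simp
  rw [← Finset.sum_range_reflect, Finset.sum_congr rfl hterm, ← Finset.mul_sum, hv, add_zero]
  have e1 := h1 N
  have e2 := h2 N
  have e4 := h2 (2 * N)
  rw [two_mul] at e4 ⊢
  rw [← eq_div_iff (mul_ne_zero e1 e2)] at hr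
  rw [hr]
  field_simp

end Kernels

/-! ## Absorption of the chain at zero -/

section Absorption

/-- The probability that the chain with kernel `P^{(s)}` started at `x` is at `0` after `M` steps. -/
def hitZero (p : ℕ) (s : ℝ) : ℕ → ℕ → ℝ
  | 0, x => if x = 0 then 1 else 0
  | M + 1, x => ∑ z ∈ Finset.range (x + 1), kernelP p s x z * hitZero p s M z

variable {p : ℕ} [Fact p.Prime] {s : ℝ}

theorem kernelP_zero_zero (hs : -1 < s) : kernelP p s 0 0 = 1 := by
  simpa using sum_kernelP (p := p) hs 0

theorem hitZero_mem_Icc (hs : -1 < s) (M x : ℕ) : hitZero p s M x ∈ Set.Icc (0 : ℝ) 1 := by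
  induction M generalizing x with
  | zero => unfold hitZero; split_ifs <;> simp
  | succ M ih =>
    refine ⟨Finset.sum_nonneg fun z _ => mul_nonneg (kernelP_nonneg hs _ _) (ih z).1, ?_⟩
    rw [← sum_kernelP (p := p) hs x]
    exact Finset.sum_le_sum fun z _ => mul_le_of_le_one_right (kernelP_nonneg hs _ _) (ih z).2

theorem hitZero_le_succ (hs : -1 < s) (M x : ℕ) : hitZero p s M x ≤ hitZero p s (M + 1) x := by
  induction M generalizing x with
  | zero =>
    by_cases hx : x = 0
    · subst hx
      simp [hitZero, kernelP_zero_zero hs]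
    · rw [hitZero, if_neg hx]
      exact (hitZero_mem_Icc hs 1 x).1
  | succ M ih =>
    rw [hitZero, hitZero]
    exact Finset.sum_le_sum fun z _ => mul_le_mul_of_nonneg_left (ih z) (kernelP_nonneg hs _ _)

/-- The monotone limit `h` is harmonic for the chain. If `h = 1` below `x`, then `(1 - P(x,x)) (h x
- 1) = 0`, and `P(x,x) < 1` for `x > 0` because `P(x,0) > 0`. -/
theorem tendsto_hitZero (hs : -1 < s) (x : ℕ) :
    Filter.Tendsto (fun M => hitZero p s M x) Filter.atTop (nhds 1) := by
  have hlim : ∀ x, ∃ h, Filter.Tendsto (fun M => hitZero p s M x) Filter.atTop (nhds h) := fun x =>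
    ⟨_, tendsto_atTop_ciSup (monotone_nat_of_le_succ fun M => hitZero_le_succ hs M x)
      ⟨1, by rintro _ ⟨M, rfl⟩; exact (hitZero_mem_Icc hs M x).2⟩⟩
  choose h hh using hlim
  have hstep : ∀ x, h x = ∑ z ∈ Finset.range (x + 1), kernelP p s x z * h z := fun x =>
    tendsto_nhds_unique ((Filter.tendsto_add_atTop_iff_nat 1).2 (hh x))
      (tendsto_finsetSum _ fun z _ => (hh z).const_mul _)
  have hone : ∀ x, h x = 1 := by
    intro x
    induction x using Nat.strong_induction_on with
    | _ x ih =>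
      rcases Nat.eq_zero_or_pos x with rfl | hx
      · refine tendsto_nhds_unique (hh 0) ?_
        have : ∀ M, hitZero p s M 0 = 1 := by
          intro M
          induction M with
          | zero => simp [hitZero]
          | succ M ih => simp [hitZero, ih, kernelP_zero_zero hs]
        simp [this]
      · have h1 := hstep x
        have h2 := sum_kernelP (p := p) hs x
        rw [Finset.sum_range_succ] at h1 h2
        rw [Finset.sum_congr rfl fun z hz => by rw [ih z (Finset.mem_range.1 hz), mul_one]] at h1
        have h3 : kernelP p s x 0 ≤ ∑ z ∈ Finset.range x, kernelP p s x z :=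
          Finset.single_le_sum (fun z _ => kernelP_nonneg hs x z) (Finset.mem_range.2 hx)
        have h4 := kernelP_pos (p := p) hs (Nat.zero_le x)
        have h5 : (1 - kernelP p s x x) * (h x - 1) = 0 := by linear_combination h1 + h2
        rcases mul_eq_zero.1 h5 with h6 | h6 <;> linarith
  simpa [hone] using hh x

end Absorption

/-! ## The law of the singular numbers on cylinder sets -/

section Law

variable {p : ℕ} [Fact p.Prime] {s : ℝ} {N : ℕ}

theorem measurable_sing : Measurable (Sing : Matrix (Fin N) (Fin N) ℚ_[p] → Delta N) := by
  refine measurable_to_countable' fun k => ?_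
  have : (Sing : Matrix (Fin N) (Fin N) ℚ_[p] → Delta N) ⁻¹' {k} =
      ⋂ i : ℤ, {Z | resCount Z ((p : ℝ) ^ i) = p ^ (N - tailSum k i)} := by
    ext Z
    simp only [Set.mem_preimage, Set.mem_singleton_iff, Set.mem_iInter, Set.mem_ofPred_eq,
      ← tailSum_sing_eq_iff]
    refine ⟨fun h i => by rw [h], fun h => eq_of_tailSum_eq fun i => ?_⟩
    have := tailSum_le (Sing Z) i
    have := tailSum_le k i
    have := h i
    omega
  rw [this]
  exact MeasurableSet.iInter fun i => (isClosed_eq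
    (continuous_resCount (zpow_pos cast_p_pos i)) continuous_const).measurableSet

/-- The `k ∈ Δ_N` with prescribed first counts. -/
def cylinder (N n m : ℕ) (x y : ℕ → ℕ) : Set (Delta N) :=
  {k | (∀ i ≤ n, tailSum k (i : ℤ) = x i) ∧ ∀ i ≤ m, N - tailSum k (-(i : ℤ)) = y i}

/-- The probability that two sampled chains start with `x` and `y`. -/
def sampleWeight (p N : ℕ) (s : ℝ) (n m : ℕ) (x y : ℕ → ℕ) : ℝ :=
  (piTilde p N s (x 0) * if y 0 = N - x 0 then 1 else 0) *
    (∏ i ∈ Finset.range n, kernelP p s (x i) (x (i + 1))) *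
    ∏ i ∈ Finset.range m, kernelP p 0 (y i) (y (i + 1))

theorem sampleWeight_nonneg (hs : -1 < s) (n m : ℕ) (x y : ℕ → ℕ) :
    0 ≤ sampleWeight p N s n m x y := by
  refine mul_nonneg (mul_nonneg (mul_nonneg (piTilde_nonneg hs _ _) ?_)
    (Finset.prod_nonneg fun i _ => kernelP_nonneg hs _ _))
    (Finset.prod_nonneg fun i _ => kernelP_zero_nonneg _ _)
  split_ifs <;> simp

/-- Time reversal: a `P^{(s)}`-step down from `x` to `y` corresponds to a `P^{(0)}`-step from `N -
y` to `N - x`. The factors `(p ^ y) ^ (-s - 2N)` and `p ^ (N * N)` are the shares of density and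
volume belonging to one level. -/
theorem piTilde_mul_kernelP (hs : -1 < s) {x y : ℕ} (hx : x ≤ N) (hy : y ≤ x) :
    piTilde p N s x * kernelP p s x y =
      ((p : ℝ) ^ y) ^ (-s - 2 * (N : ℝ)) * (p : ℝ) ^ (N * N) * kernelP p 0 (N - y) (N - x) *
        piTilde p N s y := by
  have h1 := fun n => (pochOne_pos (p := p) n).ne'
  have h2 := fun n => (pochS_pos (p := p) hs n).ne'
  have hp := cast_p_pos (p := p)
  have hpow : (p : ℝ) ^ (-((N : ℝ) - x) ^ 2) * (p : ℝ) ^ (-(y : ℝ) ^ 2 - s * y) =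
      ((p : ℝ) ^ y) ^ (-s - 2 * (N : ℝ)) * (p : ℝ) ^ (N * N) *
        (p : ℝ) ^ (-((N - x : ℕ) : ℝ) ^ 2 - 0 * ((N - x : ℕ) : ℝ)) *
          (p : ℝ) ^ (-((N : ℝ) - y) ^ 2) := by
    rw [← Real.rpow_natCast (p : ℝ) y, ← Real.rpow_natCast (p : ℝ) (N * N), ← Real.rpow_mul hp.le,
      ← Real.rpow_add hp, ← Real.rpow_add hp, ← Real.rpow_add hp, ← Real.rpow_add hp]
    congr 1
    rw [Nat.cast_sub hx]
    push_cast
    ring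
  rw [piTilde, piTilde, kernelP, kernelP, if_pos hx, if_pos (hy.trans hx), if_pos hy,
    if_pos (by omega : N - x ≤ N - y), show N - y - (N - x) = x - y by omega]
  simp only [pochS_zero_right]
  calc _ = ((p : ℝ) ^ (-((N : ℝ) - x) ^ 2) * (p : ℝ) ^ (-(y : ℝ) ^ 2 - s * y)) *
        (pochS p s N ^ 2 * pochOne p N ^ 2 / (pochS p s (2 * N) * pochOne p (N - x) ^ 2 *
          pochOne p y * pochOne p (x - y) * pochS p s y)) := by
        have := h1 x
        have := h2 x
        field_simp
    _ = _ := by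
        rw [hpow]
        have := h1 (N - y)
        have := h1 (N - x)
        field_simp

theorem piTilde_mul_prod_kernelP (hs : -1 < s) (n : ℕ) (x : ℕ → ℕ) (h0 : x 0 ≤ N)
    (hx : ∀ i < n, x (i + 1) ≤ x i) :
    piTilde p N s (x 0) * ∏ i ∈ Finset.range n, kernelP p s (x i) (x (i + 1)) =
      (∏ i ∈ Finset.range n, (((p : ℝ) ^ x (i + 1)) ^ (-s - 2 * (N : ℝ)) * (p : ℝ) ^ (N * N) *
        kernelP p 0 (N - x (i + 1)) (N - x i))) * piTilde p N s (x n) := by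
  induction n with
  | zero => simp
  | succ n ih =>
    have hle : ∀ i ≤ n, x i ≤ N := by
      intro i
      induction i with
      | zero => exact fun _ => h0
      | succ i ih => exact fun hi => (hx i (by omega)).trans (ih (by omega))
    rw [Finset.prod_range_succ, Finset.prod_range_succ, ← mul_assoc, ih fun i hi => hx i (by omega),
      mul_assoc, piTilde_mul_kernelP hs (hle n le_rfl) (hx n (by omega))]
    ring

theorem sampleWeight_eq_zero {p N : ℕ} {s : ℝ} (n m : ℕ) (x y : ℕ → ℕ)
    (h : ¬ (y 0 = N - x 0 ∧ x 0 ≤ N ∧ ∀ i < n, x (i + 1) ≤ x i)) :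
    sampleWeight p N s n m x y = 0 := by
  unfold sampleWeight
  by_cases h1 : y 0 = N - x 0
  · by_cases h2 : x 0 ≤ N
    · obtain ⟨i, hi, hlt⟩ : ∃ i < n, x i < x (i + 1) := by
        by_contra hne
        push Not at hne
        exact h ⟨h1, h2, hne⟩
      rw [Finset.prod_eq_zero (f := fun i => kernelP p s (x i) (x (i + 1))) (Finset.mem_range.2 hi)
        (kernelP_of_lt hlt)]
      ring
    · rw [piTilde, if_neg h2]
      ring
  · rw [if_neg h1]
    ring

theorem cylinder_eq_empty (n m : ℕ) (x y : ℕ → ℕ)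
    (h : ¬ (y 0 = N - x 0 ∧ x 0 ≤ N ∧ ∀ i < n, x (i + 1) ≤ x i)) : cylinder N n m x y = ∅ := by
  refine Set.eq_empty_of_forall_notMem fun k hk => h ?_
  have h0 := hk.1 0 (Nat.zero_le _)
  have h1 := hk.2 0 (Nat.zero_le _)
  simp only [Nat.cast_zero, neg_zero] at h0 h1
  refine ⟨by rw [← h1, h0], h0 ▸ tailSum_le k 0, fun i hi => ?_⟩
  rw [← hk.1 i hi.le, ← hk.1 (i + 1) hi]
  exact tailSum_antitone k (by push_cast; omega)

theorem norm_le_of_tailSum_sing_eq_zero (Z : Matrix (Fin N) (Fin N) ℚ_[p]) (n : ℕ)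
    (h : tailSum (Sing Z) n = 0) (i j : Fin N) : ‖Z i j‖ ≤ (p : ℝ) ^ n := by
  have hp : (0 : ℝ) < (p : ℝ) ^ ((n : ℤ) : ℤ) := zpow_pos cast_p_pos _
  obtain ⟨B, C, hZ⟩ := hasSingularNumbers_sing Z
  have hd : ∀ a, ‖primePowNeg p ((Sing Z).1 a)‖ < (p : ℝ) ^ (n : ℤ) := by
    intro a
    rw [norm_primePowNeg_lt_iff, ← not_le, le_apply_iff_lt_tailSum, h]
    exact Nat.not_lt_zero _
  rw [← zpow_natCast]
  refine le_of_lt ?_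
  rw [hZ, Matrix.mul_apply]
  refine norm_sum_lt _ _ hp fun a _ => ?_
  rw [Matrix.mul_diagonal, norm_mul, norm_mul]
  refine (mul_le_of_le_one_right (by positivity) (PadicInt.norm_le_one _)).trans_lt ?_
  exact (mul_le_of_le_one_left (norm_nonneg _) (PadicInt.norm_le_one _)).trans_lt (hd a)

theorem vol_preimage_cylinder (n m : ℕ) (x y : ℕ → ℕ) (hn : x n = 0) (hy : y 0 = N - x 0)
    (h0 : x 0 ≤ N) (hx : ∀ i < n, x (i + 1) ≤ x i) :
    vol p N (Sing ⁻¹' cylinder N n m x y) = ENNReal.ofReal ((p : ℝ) ^ (n * (N * N)) *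
      (kernelP p 0 N N * (∏ i ∈ Finset.range n, kernelP p 0 (N - x (i + 1)) (N - x i)) *
        ∏ i ∈ Finset.range m, kernelP p 0 (y i) (y (i + 1)))) := by
  have hle : ∀ i ≤ n, x i ≤ N := by
    intro i
    induction i with
    | zero => exact fun _ => h0
    | succ i ih => exact fun hi => (hx i (by omega)).trans (ih (by omega))
  rw [vol_eq_volume_preimage N n _ fun Z hZ => norm_le_of_tailSum_sing_eq_zero Z n
    ((hZ.1 n le_rfl).trans hn)]
  -- Dividing by `p ^ n` moves level `n - i` of `Z` to level `-i` of `W`, so `w` reads the `X`-path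
  -- backwards and then the `Y`-path; they meet at `i = n` since `y 0 = N - x 0`.
  let w : ℕ → ℕ := fun i => if i ≤ n then N - x (n - i) else y (i - n)
  have hw1 : ∀ i ≤ n, w i = N - x (n - i) := fun i hi => if_pos hi
  have hw2 : ∀ i, w (n + i) = y i := by
    intro i
    rcases Nat.eq_zero_or_pos i with rfl | hi
    · rw [add_zero, hw1 n le_rfl, Nat.sub_self, hy]
    · rw [show w (n + i) = y (n + i - n) from if_neg (by omega), Nat.add_sub_cancel_left]
  have hset : scaledCast p N n ⁻¹' (Sing ⁻¹' cylinder N n m x y) =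
      chainSet p (0 : Fin N → ℕ) (n + m) w := by
    ext W
    have hres : ∀ i : ℕ, resCount (scaleRows 0 W) ((p : ℝ) ^ (-(i : ℤ))) = p ^ w i ↔
        N - tailSum (Sing (scaledCast p N n W)) ((n : ℤ) - i) = w i := by
      intro i
      rw [tailSum_sing_eq_iff, resCount_scaledCast, ← zpow_natCast (p : ℝ) n,
        ← zpow_sub₀ cast_p_pos.ne', show (n : ℤ) - i - n = -i by ring]
      have : scaleRows 0 W = castMat (Matrix.of W) := by
        ext
        simp [scaleRows, castMat_apply]
      rw [this]
    change _ ∧ _ ↔ ∀ i ≤ n + m, resCount (scaleRows 0 W) ((p : ℝ) ^ (-(i : ℤ))) = p ^ w i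
    simp only [hres]
    constructor
    · rintro ⟨h1, h2⟩ i hi
      rcases le_total i n with hin | hin
      · rw [hw1 i hin, ← Nat.cast_sub hin, h1 _ (Nat.sub_le _ _)]
      · obtain ⟨d, rfl⟩ := Nat.exists_eq_add_of_le hin
        rw [hw2, ← h2 d (by omega)]
        congr 2
        push_cast
        ring
    · intro h
      refine ⟨fun i hi => ?_, fun i hi => ?_⟩
      · have h3 := h (n - i) (by omega)
        rw [hw1 _ (Nat.sub_le _ _), Nat.sub_sub_self hi, Nat.cast_sub hi, sub_sub_cancel] at h3
        have := hle i hi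
        have := tailSum_le (Sing (scaledCast p N n W)) i
        omega
      · have h3 := h (n + i) (by omega)
        rw [hw2] at h3
        rw [← h3]
        congr 2
        push_cast
        ring
  have hprod : ∏ i ∈ Finset.range (n + m), kernelP p 0 (w i) (w (i + 1)) =
      (∏ i ∈ Finset.range n, kernelP p 0 (N - x (i + 1)) (N - x i)) *
        ∏ i ∈ Finset.range m, kernelP p 0 (y i) (y (i + 1)) := by
    rw [Finset.prod_range_add]
    congr 1
    · rw [← Finset.prod_range_reflect]
      refine Finset.prod_congr rfl fun i hi => ?_
      have hi' := Finset.mem_range.1 hi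
      rw [hw1 _ (by omega), hw1 _ (by omega), show n - (n - 1 - i) = i + 1 by omega,
        show n - (n - 1 - i + 1) = i by omega]
    · refine Finset.prod_congr rfl fun i _ => ?_
      rw [add_assoc, hw2, hw2]
  rw [hset, volume_chainSet_zero, hprod, hw1 0 (Nat.zero_le _), Nat.sub_zero, hn, Nat.sub_zero,
    mul_assoc (kernelP p 0 N N), ENNReal.ofReal_mul (pow_nonneg cast_p_pos.le _),
    ENNReal.ofReal_pow cast_p_pos.le, ENNReal.ofReal_natCast]

theorem singularLaw_apply (S : Set (Delta N)) : singularLaw p N s S =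
    ∫⁻ Z in Sing ⁻¹' S, ENNReal.ofReal (pochS p s N ^ 2 / pochS p s (2 * N) *
      gam Z ^ (-s - 2 * (N : ℝ))) ∂vol p N := by
  have hS : MeasurableSet (Sing ⁻¹' S : Set (Matrix (Fin N) (Fin N) ℚ_[p])) :=
    measurable_sing (MeasurableSpace.measurableSet_top)
  rw [singularLaw, Measure.map_apply measurable_sing MeasurableSpace.measurableSet_top, huaMeasure,
    withDensity_apply _ hS]

theorem singularLaw_cylinder_of_eq_zero (hs : -1 < s) (n m : ℕ) (x y : ℕ → ℕ) (hn : x n = 0) :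
    singularLaw p N s (cylinder N n m x y) = ENNReal.ofReal (sampleWeight p N s n m x y) := by
  by_cases h : y 0 = N - x 0 ∧ x 0 ≤ N ∧ ∀ i < n, x (i + 1) ≤ x i
  swap
  · rw [sampleWeight_eq_zero n m x y h, cylinder_eq_empty n m x y h, measure_empty,
      ENNReal.ofReal_zero]
  obtain ⟨hy, h0, hx⟩ := h
  have hgam : Set.EqOn (fun Z : Matrix (Fin N) (Fin N) ℚ_[p] =>
      ENNReal.ofReal (pochS p s N ^ 2 / pochS p s (2 * N) * gam Z ^ (-s - 2 * (N : ℝ))))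
      (fun _ => ENNReal.ofReal (pochS p s N ^ 2 / pochS p s (2 * N) *
        ∏ i ∈ Finset.range n, ((p : ℝ) ^ x (i + 1)) ^ (-s - 2 * (N : ℝ))))
      (Sing ⁻¹' cylinder N n m x y) := by
    intro Z hZ
    have : gam Z = (p : ℝ) ^ ∑ i ∈ Finset.range n, x (i + 1) := by
      rw [gam, prod_posPow_eq (Sing Z) n ((hZ.1 n le_rfl).trans hn)]
      congr 1
      refine Finset.sum_congr rfl fun i hi => ?_
      rw [← hZ.1 (i + 1) (Finset.mem_range.1 hi)]
      push_cast
      rfl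
    simp only [this, ← Finset.prod_pow_eq_pow_sum]
    rw [Real.finsetProd_rpow _ _ fun i _ => pow_nonneg cast_p_pos.le _]
  have hS : MeasurableSet (Sing ⁻¹' cylinder N n m x y : Set (Matrix (Fin N) (Fin N) ℚ_[p])) :=
    measurable_sing (MeasurableSpace.measurableSet_top)
  have hc : 0 ≤ pochS p s N ^ 2 / pochS p s (2 * N) *
      ∏ i ∈ Finset.range n, ((p : ℝ) ^ x (i + 1)) ^ (-s - 2 * (N : ℝ)) :=
    mul_nonneg (div_nonneg (sq_nonneg _) (pochS_pos hs _).le) (Finset.prod_nonneg fun i _ =>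
      Real.rpow_nonneg (pow_nonneg cast_p_pos.le _) _)
  rw [singularLaw_apply, setLIntegral_congr_fun hS hgam, setLIntegral_const,
    vol_preimage_cylinder n m x y hn hy h0 hx, ← ENNReal.ofReal_mul hc, sampleWeight, if_pos hy,
    mul_one, piTilde_mul_prod_kernelP hs n x h0 hx, hn]
  -- The end point of the telescoped reversal is the normalising constant times the first step `N →
  -- N` of the chain of `W`.
  have hT : piTilde p N s 0 = pochS p s N ^ 2 / pochS p s (2 * N) * kernelP p 0 N N := by
    have := (pochOne_pos (p := p) N).ne'
    have := (pochS_pos (p := p) hs (2 * N)).ne'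
    have hz : pochS p s 0 = 1 := qPoch_zero _ _
    rw [piTilde, kernelP, if_pos (Nat.zero_le _), if_pos le_rfl, Nat.sub_zero, Nat.sub_self,
      pochOne_zero, pochS_zero_right, hz, Nat.cast_zero, sub_zero, zero_mul, sub_zero]
    field_simp
  rw [hT, Finset.prod_mul_distrib, Finset.prod_mul_distrib, Finset.prod_const, Finset.card_range,
    ← pow_mul, mul_comm (N * N) n]
  congr 1
  ring

theorem sampleWeight_update {p N : ℕ} {s : ℝ} (n m : ℕ) (x y : ℕ → ℕ) (z : ℕ) :
    sampleWeight p N s (n + 1) m (Function.update x (n + 1) z) y =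
      sampleWeight p N s n m x y * kernelP p s (x n) z := by
  have hx : ∀ i ≤ n, Function.update x (n + 1) z i = x i := fun i hi =>
    Function.update_of_ne (by omega) _ _
  unfold sampleWeight
  rw [Finset.prod_range_succ, hx n le_rfl, hx 0 (Nat.zero_le n), Function.update_self,
    Finset.prod_congr rfl fun i hi => by
      rw [hx i (Finset.mem_range.1 hi).le, hx (i + 1) (Finset.mem_range.1 hi)]]
  ring

/-- Induction on the number `M` of extra steps: the cylinder is split by its next value `z`,
matching the recursion of `hitZero`. -/
theorem singularLaw_cylinder_inter (hs : -1 < s) (m : ℕ) (y : ℕ → ℕ) (M : ℕ) :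
    ∀ (n : ℕ) (x : ℕ → ℕ), singularLaw p N s
      (cylinder N n m x y ∩ {k | tailSum k ((n + M : ℕ) : ℤ) = 0}) =
        ENNReal.ofReal (sampleWeight p N s n m x y * hitZero p s M (x n)) := by
  induction M with
  | zero =>
    intro n x
    by_cases hn : x n = 0
    · have : cylinder N n m x y ∩ {k | tailSum k ((n + 0 : ℕ) : ℤ) = 0} = cylinder N n m x y :=
        Set.inter_eq_left.2 fun k hk => (hk.1 n le_rfl).trans hn
      rw [this, singularLaw_cylinder_of_eq_zero hs n m x y hn, hitZero, if_pos hn, mul_one]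
    · have : cylinder N n m x y ∩ {k | tailSum k ((n + 0 : ℕ) : ℤ) = 0} = ∅ :=
        Set.eq_empty_of_forall_notMem fun k hk => hn ((hk.1.1 n le_rfl).symm.trans hk.2)
      rw [this, measure_empty, hitZero, if_neg hn, mul_zero, ENNReal.ofReal_zero]
  | succ M ih =>
    intro n x
    have hset : cylinder N n m x y ∩ {k | tailSum k ((n + (M + 1) : ℕ) : ℤ) = 0} =
        ⋃ z ∈ Finset.range (x n + 1), (cylinder N (n + 1) m (Function.update x (n + 1) z) y ∩
          {k | tailSum k ((n + 1 + M : ℕ) : ℤ) = 0}) := by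
      ext k
      simp only [Set.mem_iUnion, Set.mem_inter_iff, Set.mem_ofPred_eq, cylinder, Finset.mem_range,
        exists_prop, show n + (M + 1) = n + 1 + M by ring]
      constructor
      · rintro ⟨⟨h1, h2⟩, h3⟩
        refine ⟨tailSum k ((n + 1 : ℕ) : ℤ), ?_, ⟨fun i hi => ?_, h2⟩, h3⟩
        · rw [← h1 n le_rfl, Nat.lt_succ_iff]
          exact tailSum_antitone k (by push_cast; omega)
        · rcases Nat.lt_or_ge n i with hni | hni
          · obtain rfl : i = n + 1 := by omega
            rw [Function.update_self]
          · rw [Function.update_of_ne (by omega), h1 i hni]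
      · rintro ⟨z, -, ⟨h1, h2⟩, h3⟩
        refine ⟨⟨fun i hi => ?_, h2⟩, h3⟩
        rw [h1 i (by omega), Function.update_of_ne (by omega)]
    rw [hset, measure_biUnion_finset, hitZero, Finset.mul_sum, ENNReal.ofReal_sum_of_nonneg]
    · refine Finset.sum_congr rfl fun z _ => ?_
      rw [ih, sampleWeight_update, Function.update_self, mul_assoc]
    · exact fun z _ => mul_nonneg (sampleWeight_nonneg hs _ _ _ _)
        (mul_nonneg (kernelP_nonneg hs _ _) (hitZero_mem_Icc hs _ _).1)
    · intro z _ z' _ hzz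
      refine Set.disjoint_left.2 fun k hk hk' => hzz ?_
      have h1 := hk.1.1 (n + 1) le_rfl
      have h2 := hk'.1.1 (n + 1) le_rfl
      rw [Function.update_self] at h1 h2
      exact h1.symm.trans h2
    · exact fun z _ => MeasurableSpace.measurableSet_top

/-- Every `k` has a largest entry, so the cylinder is the increasing union of its parts with
`X_{n+M} = 0`, while the hitting probabilities tend to one. -/
theorem singularLaw_cylinder (hs : -1 < s) (n m : ℕ) (x y : ℕ → ℕ) :
    singularLaw p N s (cylinder N n m x y) = ENNReal.ofReal (sampleWeight p N s n m x y) := by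
  have hmono : Monotone fun M : ℕ =>
      cylinder N n m x y ∩ {k | tailSum k ((n + M : ℕ) : ℤ) = 0} := by
    intro M M' hM k hk
    refine ⟨hk.1, Nat.le_zero.1 (le_of_le_of_eq (tailSum_antitone k ?_) hk.2)⟩
    push_cast
    omega
  have hunion : ⋃ M : ℕ, (cylinder N n m x y ∩ {k | tailSum k ((n + M : ℕ) : ℤ) = 0}) =
      cylinder N n m x y := by
    rw [← Set.inter_iUnion, Set.inter_eq_left]
    intro k _
    obtain ⟨M, hM⟩ := exists_tailSum_eq_zero k
    refine Set.mem_iUnion.2 ⟨M, Nat.le_zero.1 (le_of_le_of_eq (tailSum_antitone k ?_) hM)⟩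
    push_cast
    omega
  have h1 := tendsto_measure_iUnion_atTop (μ := singularLaw p N s) hmono
  rw [hunion] at h1
  simp only [Function.comp_def, singularLaw_cylinder_inter hs] at h1
  have h2 := (tendsto_hitZero (p := p) hs (x n)).const_mul (sampleWeight p N s n m x y)
  rw [mul_one] at h2
  exact tendsto_nhds_unique h1 (ENNReal.tendsto_ofReal h2)

theorem singularLaw_univ (hs : -1 < s) : singularLaw p N s Set.univ = 1 := by
  have hset : (Set.univ : Set (Delta N)) = ⋃ z ∈ Finset.range (N + 1),
      cylinder N 0 0 (fun _ => z) (fun _ => N - z) := by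
    refine (Set.eq_univ_of_forall fun k => ?_).symm
    simp only [Set.mem_iUnion, Finset.mem_range, exists_prop]
    refine ⟨tailSum k 0, Nat.lt_succ_iff.2 (tailSum_le k 0), fun i hi => ?_, fun i hi => ?_⟩ <;>
    · obtain rfl := Nat.le_zero.1 hi
      simp
  rw [hset, measure_biUnion_finset, ← ENNReal.ofReal_one, ← sum_piTilde (p := p) hs N,
    ENNReal.ofReal_sum_of_nonneg fun z _ => piTilde_nonneg hs N z]
  · refine Finset.sum_congr rfl fun z _ => ?_
    rw [singularLaw_cylinder hs]
    simp [sampleWeight]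
  · intro z _ z' _ hzz
    refine Set.disjoint_left.2 fun k hk hk' => hzz ?_
    exact (hk.1 0 le_rfl).symm.trans (hk'.1 0 le_rfl)
  · exact fun z _ => MeasurableSpace.measurableSet_top

theorem isProbabilityMeasure_singularLaw (hs : -1 < s) : IsProbabilityMeasure (singularLaw p N s) :=
  ⟨singularLaw_univ hs⟩

theorem isProbabilityMeasure_huaMeasure (hs : -1 < s) : IsProbabilityMeasure (huaMeasure p N s) :=
  ⟨by
    rw [← singularLaw_univ (p := p) (N := N) hs, singularLaw,
      Measure.map_apply measurable_sing MeasurableSet.univ, Set.preimage_univ]⟩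

theorem isTwoChainSample_singularLaw (hs : -1 < s) : IsTwoChainSample p N s (singularLaw p N s)
    (fun i k => tailSum k (i : ℤ)) (fun i k => N - tailSum k (-(i : ℤ))) where
  measurable_X _ := fun _ _ => MeasurableSpace.measurableSet_top
  measurable_Y _ := fun _ _ => MeasurableSpace.measurableSet_top
  law n m x y := singularLaw_cylinder hs n m x y

end Law

/-! ## Reconstructing the singular numbers from the chains -/

section Reconstruction

variable {p : ℕ} {s : ℝ} {N : ℕ}

theorem IsTwoChainSample.measurableSet {Ω : Type*} [MeasurableSpace Ω] {μ : Measure Ω}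
    {X Y : ℕ → Ω → ℕ} (h : IsTwoChainSample p N s μ X Y) (n m : ℕ) (x y : ℕ → ℕ) :
    MeasurableSet {ω | (∀ i ≤ n, X i ω = x i) ∧ ∀ i ≤ m, Y i ω = y i} := by
  have : {ω | (∀ i ≤ n, X i ω = x i) ∧ ∀ i ≤ m, Y i ω = y i} =
      (⋂ i, ⋂ (_ : i ≤ n), X i ⁻¹' {x i}) ∩ ⋂ i, ⋂ (_ : i ≤ m), Y i ⁻¹' {y i} := by
    ext
    simp
  rw [this]
  exact (MeasurableSet.iInter fun i => MeasurableSet.iInter fun _ =>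
    h.measurable_X i (measurableSet_singleton _)).inter (MeasurableSet.iInter fun i =>
    MeasurableSet.iInter fun _ => h.measurable_Y i (measurableSet_singleton _))

theorem setOf_forall_eq_iInter {Ω : Type*} (X Y : ℕ → Ω → ℕ) (x y : ℕ → ℕ) :
    {ω | ∀ i, X i ω = x i ∧ Y i ω = y i} =
      ⋂ n, {ω | (∀ i ≤ n, X i ω = x i) ∧ ∀ i ≤ n, Y i ω = y i} := by
  ext ω
  simp only [Set.mem_ofPred_eq, Set.mem_iInter]
  exact ⟨fun h n => ⟨fun i _ => (h i).1, fun i _ => (h i).2⟩,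
    fun h i => ⟨(h i).1 i le_rfl, (h i).2 i le_rfl⟩⟩

theorem IsTwoChainSample.measurableSet_forall {Ω : Type*} [MeasurableSpace Ω] {μ : Measure Ω}
    {X Y : ℕ → Ω → ℕ} (h : IsTwoChainSample p N s μ X Y) (x y : ℕ → ℕ) :
    MeasurableSet {ω | ∀ i, X i ω = x i ∧ Y i ω = y i} := by
  rw [setOf_forall_eq_iInter]
  exact MeasurableSet.iInter fun n => h.measurableSet n n x y

theorem IsTwoChainSample.tendsto_measure {Ω : Type*} [MeasurableSpace Ω] {μ : Measure Ω}
    [IsFiniteMeasure μ] {X Y : ℕ → Ω → ℕ} (h : IsTwoChainSample p N s μ X Y) (x y : ℕ → ℕ) :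
    Filter.Tendsto (fun n => ENNReal.ofReal (sampleWeight p N s n n x y)) Filter.atTop
      (nhds (μ {ω | ∀ i, X i ω = x i ∧ Y i ω = y i})) := by
  have h1 := tendsto_measure_iInter_atTop (μ := μ)
    (s := fun n => {ω | (∀ i ≤ n, X i ω = x i) ∧ ∀ i ≤ n, Y i ω = y i})
    (fun n => (h.measurableSet n n x y).nullMeasurableSet)
    (fun n n' hn ω hω => ⟨fun i hi => hω.1 i (hi.trans hn), fun i hi => hω.2 i (hi.trans hn)⟩)
    ⟨0, measure_ne_top _ _⟩
  rw [← setOf_forall_eq_iInter] at h1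
  simpa only [Function.comp_def, h.law, sampleWeight] using h1

/-- The event that the chains are the counts of `k`. -/
def countsEvent {Ω : Type*} (N : ℕ) (X Y : ℕ → Ω → ℕ) (k : Delta N) : Set Ω :=
  {ω | ∀ i : ℕ, X i ω = tailSum k (i : ℤ) ∧ Y i ω = N - tailSum k (-(i : ℤ))}

theorem eq_of_counts_eq {k k' : Delta N} (h : ∀ i : ℕ, tailSum k (i : ℤ) = tailSum k' (i : ℤ) ∧
    N - tailSum k (-(i : ℤ)) = N - tailSum k' (-(i : ℤ))) : k = k' := by
  refine eq_of_tailSum_eq fun i => ?_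
  obtain ⟨n, rfl | rfl⟩ := Int.eq_nat_or_neg i
  · exact (h n).1
  · have := (h n).2
    have := tailSum_le k (-(n : ℤ))
    have := tailSum_le k' (-(n : ℤ))
    omega

variable [Fact p.Prime]

/-- Both sides are limits of the same cylinder weights: `singularLaw` carries a sample itself, for
which the event is `{k}` because counts determine `k`. -/
theorem IsTwoChainSample.measure_countsEvent (hs : -1 < s) {Ω : Type*} [MeasurableSpace Ω]
    {μ : Measure Ω} [IsFiniteMeasure μ] {X Y : ℕ → Ω → ℕ} (h : IsTwoChainSample p N s μ X Y)
    (k : Delta N) : μ (countsEvent N X Y k) = singularLaw p N s {k} := by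
  have := isProbabilityMeasure_singularLaw (p := p) (N := N) hs
  have h2 := (isTwoChainSample_singularLaw (p := p) (N := N) hs).tendsto_measure
    (fun i => tailSum k (i : ℤ)) (fun i => N - tailSum k (-(i : ℤ)))
  have hk : {k' : Delta N | ∀ i : ℕ, tailSum k' (i : ℤ) = tailSum k (i : ℤ) ∧
      N - tailSum k' (-(i : ℤ)) = N - tailSum k (-(i : ℤ))} = {k} := by
    ext k'
    exact ⟨fun h => eq_of_counts_eq h, by rintro rfl; exact fun i => ⟨rfl, rfl⟩⟩
  rw [hk] at h2
  exact tendsto_nhds_unique (h.tendsto_measure _ _) h2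

/-- The countably many events are disjoint and their masses are the atoms of a probability measure,
so their union has full measure. -/
theorem IsTwoChainSample.ae_exists_counts (hs : -1 < s) {Ω : Type*} [MeasurableSpace Ω]
    {μ : Measure Ω} [IsProbabilityMeasure μ] {X Y : ℕ → Ω → ℕ}
    (h : IsTwoChainSample p N s μ X Y) : ∀ᵐ ω ∂μ, ∃ k, ω ∈ countsEvent N X Y k := by
  have hm : ∀ k, MeasurableSet (countsEvent N X Y k) := fun k => h.measurableSet_forall _ _
  have hdisj : Pairwise (Function.onFun Disjoint (countsEvent N X Y)) := by
    intro k k' hkk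
    refine Set.disjoint_left.2 fun ω hω hω' => hkk (eq_of_counts_eq fun i => ?_)
    exact ⟨(hω i).1.symm.trans (hω' i).1, (hω i).2.symm.trans (hω' i).2⟩
  have hU : μ (⋃ k, countsEvent N X Y k) = 1 := by
    rw [measure_iUnion hdisj hm, tsum_congr fun k => h.measure_countsEvent hs k,
      ← singularLaw_univ (p := p) (N := N) hs, ← Set.iUnion_of_singleton,
      measure_iUnion (fun k k' hkk => Set.disjoint_singleton.2 hkk)
        fun k => MeasurableSpace.measurableSet_top]
  have := (prob_compl_eq_zero_iff (MeasurableSet.iUnion hm)).2 hU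
  filter_upwards [measure_eq_zero_iff_ae_notMem.1 this] with ω hω
  simpa using hω

theorem IsTwoChainSample.exists_measurable_delta (hs : -1 < s) {Ω : Type*} [MeasurableSpace Ω]
    {μ : Measure Ω} [IsProbabilityMeasure μ] {X Y : ℕ → Ω → ℕ}
    (h : IsTwoChainSample p N s μ X Y) : ∃ k : Ω → Delta N, Measurable k ∧
      ∀ᵐ ω ∂μ, ∀ i : ℕ, tailSum (k ω) (i : ℤ) = X i ω ∧ N - tailSum (k ω) (-(i : ℤ)) = Y i ω := by
  classical
  -- The default is used only on the null set where the sequences are not the counts of any `k`.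
  let k : Ω → Delta N := fun ω =>
    if hω : ∃ k, ω ∈ countsEvent N X Y k then hω.choose else default
  have hm : ∀ k, MeasurableSet (countsEvent N X Y k) := fun k => h.measurableSet_forall _ _
  have hk : ∀ ω, (∃ k, ω ∈ countsEvent N X Y k) → ω ∈ countsEvent N X Y (k ω) := by
    intro ω hω
    simp only [k, dif_pos hω]
    exact hω.choose_spec
  refine ⟨k, measurable_to_countable' fun k₀ => ?_, ?_⟩
  · have hpre : k ⁻¹' {k₀} = countsEvent N X Y k₀ ∪
        ((⋃ k, countsEvent N X Y k)ᶜ ∩ {_ω | default = k₀}) := by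
      ext ω
      by_cases hω : ∃ k, ω ∈ countsEvent N X Y k
      · have h1 := hk ω hω
        simp only [Set.mem_preimage, Set.mem_singleton_iff, Set.mem_union, Set.mem_inter_iff,
          Set.mem_compl_iff, Set.mem_iUnion, hω, not_true_eq_false, false_and, or_false]
        refine ⟨fun h2 => h2 ▸ h1, fun h2 => eq_of_counts_eq fun i => ?_⟩
        exact ⟨(h1 i).1.symm.trans (h2 i).1, (h1 i).2.symm.trans (h2 i).2⟩
      · have hd : k ω = default := dif_neg hω
        have hn : ω ∉ countsEvent N X Y k₀ := fun h1 => hω ⟨_, h1⟩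
        simp [hd, hn, not_exists.1 hω]
    rw [hpre]
    exact (hm k₀).union ((MeasurableSet.iUnion hm).compl.inter (MeasurableSet.const _))
  · filter_upwards [h.ae_exists_counts hs] with ω hω i
    exact ⟨((hk ω hω) i).1.symm, ((hk ω hω) i).2.symm⟩

theorem IsTwoChainSample.map_eq_singularLaw (hs : -1 < s) {Ω : Type*} [MeasurableSpace Ω]
    {μ : Measure Ω} [IsProbabilityMeasure μ] {X Y : ℕ → Ω → ℕ}
    (h : IsTwoChainSample p N s μ X Y) {k : Ω → Delta N} (hk : Measurable k)
    (hXY : ∀ᵐ ω ∂μ, ∀ i : ℕ, tailSum (k ω) (i : ℤ) = X i ω ∧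
      N - tailSum (k ω) (-(i : ℤ)) = Y i ω) : μ.map k = singularLaw p N s := by
  have : MeasurableSingletonClass (Delta N) := ⟨fun _ => MeasurableSpace.measurableSet_top⟩
  refine Measure.ext_of_singleton fun k₀ => ?_
  rw [Measure.map_apply hk (measurableSet_singleton k₀), ← h.measure_countsEvent hs k₀]
  refine measure_congr ?_
  filter_upwards [hXY] with ω hω
  refine propext ⟨?_, fun h2 => ?_⟩
  · rintro rfl
    exact fun i => ⟨(hω i).1.symm, (hω i).2.symm⟩
  · exact eq_of_counts_eq fun i => ⟨(hω i).1.trans (h2 i).1, (hω i).2.trans (h2 i).2⟩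

end Reconstruction

end PadicHua

end

open MeasureTheory PadicHua in
theorem theorem3p4 (p : ℕ) [Fact p.Prime] (N : ℕ) (s : ℝ) (hs : -1 < s) :
    -- the weights form a probability measure on `{0, …, N}`
    ((∀ x ≤ N, 0 ≤ piTilde p N s x) ∧ ∑ x ∈ Finset.range (N + 1), piTilde p N s x = 1) ∧
    -- the two kernels are Markov kernels
    (IsTransitionKernel (kernelP p s) ∧ IsTransitionKernel (kernelP p 0)) ∧
    -- the matrix measure and the law of its singular numbers are probability measures
    (IsProbabilityMeasure (huaMeasure p N s) ∧ IsProbabilityMeasure (singularLaw p N s)) ∧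
    -- if `k` has law `m_N^{(s)}`, then its counts are distributed as the two chains
    IsTwoChainSample p N s (singularLaw p N s)
      (fun i k => tailSum k (i : ℤ)) (fun i k => N - tailSum k (-(i : ℤ))) ∧
    -- conversely, two chains sampled by the procedure are almost surely the counts of a random
    -- `k`, and every such `k` has law `m_N^{(s)}`
    (∀ (Ω : Type*) [MeasurableSpace Ω] (μ : Measure Ω) [IsProbabilityMeasure μ]
      (X Y : ℕ → Ω → ℕ), IsTwoChainSample p N s μ X Y →
      (∃ k : Ω → Delta N, Measurable k ∧
        ∀ᵐ ω ∂μ, ∀ i : ℕ, tailSum (k ω) (i : ℤ) = X i ω ∧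
          N - tailSum (k ω) (-(i : ℤ)) = Y i ω) ∧
      ∀ k : Ω → Delta N, Measurable k →
        (∀ᵐ ω ∂μ, ∀ i : ℕ, tailSum (k ω) (i : ℤ) = X i ω ∧
          N - tailSum (k ω) (-(i : ℤ)) = Y i ω) →
        μ.map k = singularLaw p N s) := by
  refine ⟨⟨fun x _ => piTilde_nonneg hs N x, sum_piTilde hs N⟩,
    ⟨isTransitionKernel_kernelP hs, isTransitionKernel_kernelP (by norm_num)⟩,
    ⟨isProbabilityMeasure_huaMeasure hs, isProbabilityMeasure_singularLaw hs⟩,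
    isTwoChainSample_singularLaw hs, fun Ω _ μ _ X Y h => ⟨h.exists_measurable_delta hs, ?_⟩⟩
  exact fun k hk hXY => h.map_eq_singularLaw hs hk hXY
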